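/- **Corollary 4.5.** The parameterized problem Profile Above Vertex Guaranteed Value (PAVGV) is fixed-parameter tractable. Here an *ordering* of a finite simple graph $G=(V,E)$ is a bijection $\alpha:V\to\{1,\dots,|V|\}$, the closed neighborhood of a vertex $v$ is $N[v]=\{u\in V: uv\in E\}\cup\{v\}$, and the *profile* of $\alpha$ is $$\mathrm{prf}_\alpha(G)=\sum_{v\in V}\bigl(\alpha(v)-\min\{\alpha(u):u\in N[v]\}\bigr).$$ PAVGV is the set of all pairs $(G,k)$, where $G=(V,E)$ is a (non-empty) connected graph and the parameter $k$ is a positive integer, such that $G$ has an ordering of profile at most $|V|-1+k$. Fixed-parameter tractability means: there are a computable function $f:\mathbb N\to\mathbb N$, a constant $c$ and a single algorithm (a program for a random access machine with addition and truncated subtraction, at unit cost) that, given a finite graph $G$ by the bits of its adjacency matrix and an integer $k\ge 0$, decides whether $(G,k)\in\mathrm{PAVGV}$ in time $O(f(k)\,|G|^c)$, where $|G|$ is the length of the input string ($|G|+1$ in place of $|G|$ for the empty graph). -/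

import Mathlib

/-! ### Orderings and profile of a graph -/

/-- The closed neighbourhood `N[v] = {u : uv ∈ E} ∪ {v}`. -/
noncomputable def closedNbhd {V : Type*} [Fintype V] (G : SimpleGraph V) (v : V) : Finset V :=
  open Classical in Finset.univ.filter fun u => u = v ∨ G.Adj v u

theorem closedNbhd_nonempty {V : Type*} [Fintype V] (G : SimpleGraph V) (v : V) :
    (closedNbhd G v).Nonempty :=
  ⟨v, by simp [closedNbhd]⟩

/-- An ordering of the vertices: a bijection onto `{0, …, |V| - 1}`. Only differences of positions
are ever used, so counting from `0` instead of `1` changes nothing. -/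
abbrev VertexOrdering (V : Type*) [Fintype V] : Type _ := V ≃ Fin (Fintype.card V)

/-- The profile `α(v) - min {α(u) : u ∈ N[v]}` of the vertex `v` in the ordering `α`. The natural
number subtraction does not truncate, because `v ∈ N[v]`. -/
noncomputable def vertexProfile {V : Type*} [Fintype V] (G : SimpleGraph V)
    (α : VertexOrdering V) (v : V) : ℕ :=
  (α v : ℕ) - (closedNbhd G v).inf' (closedNbhd_nonempty G v) fun u => (α u : ℕ)

/-- The profile `prf_α(G)` of the ordering `α`. -/
noncomputable def orderingProfile {V : Type*} [Fintype V] (G : SimpleGraph V)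
    (α : VertexOrdering V) : ℕ :=
  ∑ v, vertexProfile G α v

/-! ### Random access machines with unit cost

The machine has registers and one-dimensional arrays, all holding natural numbers. A program
mentions only finitely many registers and arrays, by fixed names. The only arithmetic operations
are addition and truncated subtraction (no multiplication), so that the number of steps is
polynomially related to the number of steps of a Turing machine. -/

namespace RAM

structure State where
  reg : ℕ → ℕ
  arr : ℕ → ℕ → ℕ

/-- `var x` is the content of register `x`; `get a e` is the entry of array `a` at index `e`. -/
inductive Expr where
  | const (c : ℕ)
  | var (x : ℕ)
  | get (a : ℕ) (e : Expr)
  | add (e₁ e₂ : Expr)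
  | sub (e₁ e₂ : Expr)

/-- The value of an expression; subtraction is truncated at `0`. -/
def Expr.eval (s : State) : Expr → ℕ
  | const c => c
  | var x => s.reg x
  | get a e => s.arr a (e.eval s)
  | add e₁ e₂ => e₁.eval s + e₂.eval s
  | sub e₁ e₂ => e₁.eval s - e₂.eval s

/-- The number of steps needed to evaluate an expression: one for each operation in it. -/
def Expr.cost : Expr → ℕ
  | const _ => 1
  | var _ => 1
  | get _ e => e.cost + 1
  | add e₁ e₂ => e₁.cost + e₂.cost + 1
  | sub e₁ e₂ => e₁.cost + e₂.cost + 1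

/-- Programs. `set x e` is `x := e` and `put a i e` is `a[i] := e`. In `ite e p q` and `loop e p`
the test is whether `e` is non-zero. -/
inductive Program where
  | skip
  | set (x : ℕ) (e : Expr)
  | put (a : ℕ) (i e : Expr)
  | seq (p q : Program)
  | ite (e : Expr) (p q : Program)
  | loop (e : Expr) (p : Program)

def State.setReg (s : State) (x v : ℕ) : State :=
  { s with reg := Function.update s.reg x v }

def State.setArr (s : State) (a i v : ℕ) : State :=
  { s with arr := Function.update s.arr a (Function.update (s.arr a) i v) }

/-- `Runs p s t s'`: started in state `s`, the program `p` halts in state `s'` after exactly `t`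
steps. The machine is deterministic: `s` determines at most one pair `t`, `s'`. -/
inductive Runs : Program → State → ℕ → State → Prop
  | skip (s : State) : Runs .skip s 1 s
  | set (x : ℕ) (e : Expr) (s : State) :
      Runs (.set x e) s (e.cost + 1) (s.setReg x (e.eval s))
  | put (a : ℕ) (i e : Expr) (s : State) :
      Runs (.put a i e) s (i.cost + e.cost + 1) (s.setArr a (i.eval s) (e.eval s))
  | seq {p q : Program} {s₁ s₂ s₃ : State} {t₁ t₂ : ℕ} :
      Runs p s₁ t₁ s₂ → Runs q s₂ t₂ s₃ → Runs (.seq p q) s₁ (t₁ + t₂) s₃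
  | ite_true {e : Expr} {p q : Program} {s s' : State} {t : ℕ} :
      e.eval s ≠ 0 → Runs p s t s' → Runs (.ite e p q) s (e.cost + 1 + t) s'
  | ite_false {e : Expr} {p q : Program} {s s' : State} {t : ℕ} :
      e.eval s = 0 → Runs q s t s' → Runs (.ite e p q) s (e.cost + 1 + t) s'
  | loop_done {e : Expr} {p : Program} {s : State} :
      e.eval s = 0 → Runs (.loop e p) s (e.cost + 1) s
  | loop_step {e : Expr} {p : Program} {s₁ s₂ s₃ : State} {t₁ t₂ : ℕ} :
      e.eval s₁ ≠ 0 → Runs p s₁ t₁ s₂ → Runs (.loop e p) s₂ t₂ s₃ →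
        Runs (.loop e p) s₁ (e.cost + 1 + t₁ + t₂) s₃

/-- The initial state on the bit string `w` and the parameter `k`: register `0` holds the length of
`w`, register `1` holds `k`, array `0` holds the bits of `w`, and everything else is `0`. -/
def init (w : List Bool) (k : ℕ) : State where
  reg x := if x = 0 then w.length else if x = 1 then k else 0
  arr a i := if a = 0 then (w.getD i false).toNat else 0

end RAM

/-! ### Parameterized problems -/

/-- The parameterized problem `Q`, a set of pairs (instance, parameter), is fixed-parameter
tractable: one program decides membership of `(I, k)` in `Q` in time `O(f(k) |I|^c)` with `f`
computable and `c` constant, where `|I|` is the length of the bit string `enc I` that represents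
`I`. The implicit constant is absorbed into `f`, and `|I| + 1` in place of `|I|` only matters
for `|I| = 0`. The answer is read off register `0`: `1` for "yes" and `0` for "no". -/
def FixedParameterTractable {ι : Type*} (enc : ι → List Bool) (Q : Set (ι × ℕ)) : Prop :=
  ∃ (p : RAM.Program) (f : ℕ → ℕ) (c : ℕ), Computable f ∧
    ∀ (I : ι) (k : ℕ), ∃ (t : ℕ) (s : RAM.State),
      RAM.Runs p (RAM.init (enc I) k) t s ∧
      t ≤ f k * ((enc I).length + 1) ^ c ∧
      ((I, k) ∈ Q → s.reg 0 = 1) ∧ ((I, k) ∉ Q → s.reg 0 = 0)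

/-- Finite simple graphs, with vertex set `{0, …, n - 1}`. -/
abbrev FinGraph : Type := Σ n : ℕ, SimpleGraph (Fin n)

/-- The adjacency matrix, row by row: the bit at position `i * n + j` is `1` iff `ij ∈ E`. -/
noncomputable def FinGraph.encode (G : FinGraph) : List Bool :=
  open Classical in List.ofFn fun t : Fin (G.1 * G.1) => decide (G.2.Adj t.divNat t.modNat)

/-- Profile Above Vertex Guaranteed Value: the connected graphs `G` and positive parameters `k` such
that `G` has an ordering of profile at most `|V| - 1 + k`. Here `Connected` includes `V ≠ ∅`. -/
def PAVGV : Set (FinGraph × ℕ) :=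
  {x | x.1.2.Connected ∧ 0 < x.2 ∧
    ∃ α : VertexOrdering (Fin x.1.1), orderingProfile x.1.2 α ≤ x.1.1 - 1 + x.2}

/-!
# Profile Above Vertex Guaranteed Value is fixed-parameter tractable

Let `S₁ ⊂ S₂ ⊂ ⋯ ⊂ Sₙ = V` be the sets of the first vertices of an ordering, and let `N(S)` be the
set of vertices outside `S` with a neighbour in `S`. The profile of the ordering is `∑ |N(Sᵢ)|`
(`orderingProfile_eq_sum`). If the graph is connected, every summand but the last is at least `1`,
so the question is whether the vertices can be ordered with total excess `∑ (|N(Sᵢ)| - 1) ≤ k`, the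
empty boundary of `Sₙ` counting `0` (`Completable`). An ordering is built by adding one vertex at a
time to a set `S`, with two rules.

* If some vertex `v` satisfies `|N(S ∪ {v})| ≤ 1`, it may be added at once: `S ↦ |N(S)|` is
  submodular, so moving `v` forward makes no other boundary larger
  (`Completable.insert_of_thin`).
* Otherwise the next set has positive excess, which happens at most `k` times. The next vertex is
  within distance `k + 2` of `S`, because a set with boundary of size at most one follows after few
  additions, and this set together with its boundary is connected (`Completable.mem_layer`).
  Moreover every vertex outside `S` has at most `2k + 3` neighbours outside `S` that are not leaves,
  because adding such a neighbour before the vertex itself is charged to a set of positive excess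
  (`Completable.card_branchNbrs_le`), and leaves at the same vertex are interchangeable
  (`Completable.insert_twin`). Hence the next vertex is the end of a walk given by `k + 2` digits
  below `2k + 6` (`exists_walk`, `exists_walk_pendant`).

So an ordering is determined by its first vertex and at most `k (k + 2)` digits, which are packed
into one number below `codeBound k`. The algorithm tries all first vertices and all numbers
(`exists_search_iff`). Each attempt takes time polynomial in `n` and `codeBound k`, and every
success yields an actual ordering, whatever the guiding number is.

The random access machine is treated with a program logic for total correctness with time bounds
(`Exec`). A program leaves the registers and arrays that it does not mention as targets unchanged
(`frame_of_runs`), so the specification of a subroutine names only its results.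
-/

/-! ### Boundaries of vertex sets and completions of partial orderings -/

namespace ProfileFPT

open Finset

section Combinatorics

variable {V : Type*} [Fintype V] [DecidableEq V] {G : SimpleGraph V}

open Classical in
/-- The vertices outside `S` that have a neighbour in `C`. -/
noncomputable def outNbrs (G : SimpleGraph V) (S C : Finset V) : Finset V :=
  univ.filter fun x => x ∉ S ∧ ∃ y ∈ C, G.Adj y x

/-- The boundary `N(S)`: the vertices outside `S` that have a neighbour in `S`. -/
noncomputable abbrev bdry (G : SimpleGraph V) (S : Finset V) : Finset V := outNbrs G S S

theorem mem_outNbrs {S C : Finset V} {x : V} :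
    x ∈ outNbrs G S C ↔ x ∉ S ∧ ∃ y ∈ C, G.Adj y x := by
  simp [outNbrs]

theorem bdry_univ : bdry G univ = ∅ := by
  ext x; simp [mem_outNbrs]

theorem bdry_nonempty (hG : G.Connected) {S : Finset V} (hS : S.Nonempty) (hS' : S ≠ univ) :
    (bdry G S).Nonempty := by
  obtain ⟨a, ha⟩ := hS
  obtain ⟨b, hb⟩ : ∃ b, b ∉ S := by
    by_contra! h
    exact hS' (eq_univ_iff_forall.2 h)
  obtain ⟨p⟩ := hG.preconnected a b
  obtain ⟨d, -, h1, h2⟩ :=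
    p.exists_boundary_dart (S : Set V) (by simpa using ha) (by simpa using hb)
  exact ⟨d.snd, mem_outNbrs.2 ⟨by simpa using h2, d.fst, by simpa using h1, d.adj⟩⟩

/-- Submodularity of `S ↦ |N(S)|`, for the insertion of one vertex. -/
theorem card_bdry_insert_add_le {S T : Finset V} (hST : S ⊆ T) {v : V} (hv : v ∉ T) :
    #(bdry G (insert v T)) + #(bdry G S) ≤ #(bdry G T) + #(bdry G (insert v S)) := by
  have hT := card_sdiff_add_card (bdry G (insert v T)) (bdry G T)
  have hT' := card_sdiff_add_card (bdry G T) (bdry G (insert v T))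
  have hS := card_sdiff_add_card (bdry G (insert v S)) (bdry G S)
  have hS' := card_sdiff_add_card (bdry G S) (bdry G (insert v S))
  rw [union_comm] at hT' hS'
  have h1 : bdry G (insert v T) \ bdry G T ⊆ bdry G (insert v S) \ bdry G S := by
    intro x
    simp only [mem_sdiff, mem_outNbrs, mem_insert, not_or]
    rintro ⟨⟨⟨hxv, hxT⟩, y, hy, hyx⟩, h⟩
    have hyv : y = v := by
      rcases hy with rfl | hy
      · rfl
      · exact absurd ⟨hxT, y, hy, hyx⟩ h
    subst hyv
    exact ⟨⟨⟨hxv, fun hx => hxT (hST hx)⟩, y, Or.inl rfl, hyx⟩,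
      fun ⟨_, z, hz, hzx⟩ => h ⟨hxT, z, hST hz, hzx⟩⟩
  have h2 : bdry G S \ bdry G (insert v S) ⊆ bdry G T \ bdry G (insert v T) := by
    intro x
    simp only [mem_sdiff, mem_outNbrs, mem_insert, not_or]
    rintro ⟨⟨hxS, y, hy, hyx⟩, h⟩
    have hxv : x = v := by
      by_contra hxv
      exact h ⟨⟨hxv, hxS⟩, y, Or.inr hy, hyx⟩
    subst hxv
    exact ⟨⟨hv, y, hST hy, hyx⟩, fun h => h.1.1 rfl⟩
  have := card_le_card h1
  have := card_le_card h2
  omega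

/-- `Completable G S b` says that the vertices outside `S` can be added to `S` one by one such that
the sets `T` passed after `S` satisfy `∑ (|N(T)| - 1) ≤ b`. The truncated subtraction matters only
for `T = V` if `G` is connected. -/
inductive Completable (G : SimpleGraph V) : Finset V → ℕ → Prop
  | full (b : ℕ) : Completable G univ b
  | step {S : Finset V} {v : V} {b c : ℕ} (hv : v ∉ S) (h : Completable G (insert v S) b)
      (hc : b + (#(bdry G (insert v S)) - 1) ≤ c) : Completable G S c

theorem Completable.mono {S : Finset V} {b c : ℕ} (h : Completable G S b) (hbc : b ≤ c) :
    Completable G S c := by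
  cases h with
  | full => exact .full _
  | step hv h hc => exact .step hv h (hc.trans hbc)

/-- A vertex whose addition to `S` leaves a boundary of size at most one may be added at once: by
submodularity, adding it earlier makes no later boundary larger. -/
theorem Completable.insert_of_thin (hG : G.Connected) {S : Finset V} {v : V} (hS : S.Nonempty)
    (hv : v ∉ S) (hthin : #(bdry G (insert v S)) ≤ 1) {b : ℕ} (h : Completable G S b) :
    Completable G (insert v S) b := by
  have hS1 : 1 ≤ #(bdry G S) :=
    card_pos.2 (bdry_nonempty hG hS fun h => hv (h ▸ mem_univ v))
  suffices H : ∀ T b, Completable G T b → S ⊆ T → Completable G (insert v T) b from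
    H S b h Subset.rfl
  intro T b hT
  induction hT with
  | full b => intro _; simpa using Completable.full b
  | @step T x b c hx hT hc ih =>
    intro hST
    by_cases hxv : x = v
    · subst hxv; exact hT.mono (by omega)
    by_cases hvT : v ∈ T
    · rw [insert_eq_of_mem hvT]; exact .step hx hT hc
    have h1 := ih (hST.trans (subset_insert _ _))
    rw [insert_comm] at h1
    refine .step (v := x) (by simp [hx, hxv]) h1 ?_
    have h2 := card_bdry_insert_add_le (G := G) (hST.trans (subset_insert x T)) (v := v)
      (by simp [hvT, Ne.symm hxv])
    rw [insert_comm] at h2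
    omega

/-- A completion of small excess reaches a set with a boundary of size at most one soon. -/
theorem Completable.exists_thin {S : Finset V} {b : ℕ} (h : Completable G S b) :
    ∃ T, S ⊆ T ∧ #(bdry G T) ≤ 1 ∧ #(T \ S) ≤ b + (#(bdry G S) - 1) := by
  induction h with
  | full b => exact ⟨univ, Subset.rfl, by simp [bdry_univ], by simp⟩
  | @step S x b c hx h hc ih =>
    by_cases hS : #(bdry G S) ≤ 1
    · exact ⟨S, Subset.rfl, hS, by simp⟩
    obtain ⟨T, hST, hT, hcard⟩ := ih
    refine ⟨T, (subset_insert _ _).trans hST, hT, ?_⟩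
    have h1 := card_sdiff_of_subset hST
    have h2 := card_sdiff_of_subset ((subset_insert _ _).trans hST)
    have h3 := card_insert_of_notMem hx
    have h4 := card_le_card hST
    omega

/-- The vertices outside `S` at distance between `1` and `r` from `S`, measured along paths that
leave `S` in their first step. -/
noncomputable def layer (G : SimpleGraph V) (S : Finset V) : ℕ → Finset V
  | 0 => ∅
  | r + 1 => layer G S r ∪ outNbrs G S (S ∪ layer G S r)

theorem layer_mono (S : Finset V) : Monotone (layer G S) :=
  monotone_nat_of_le_succ fun _ => subset_union_left

theorem disjoint_layer (S : Finset V) (r : ℕ) : Disjoint S (layer G S r) := by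
  induction r with
  | zero => simp [layer]
  | succ r ih =>
    refine disjoint_union_right.2 ⟨ih, disjoint_left.2 fun x hx h => ?_⟩
    exact (mem_outNbrs.1 h).1 hx

theorem exists_adj_of_mem_layer_succ {S : Finset V} {r : ℕ} {x : V}
    (hx : x ∈ layer G S (r + 1)) : ∃ y ∈ S ∪ layer G S r, G.Adj y x := by
  induction r with
  | zero => simpa [layer, mem_outNbrs] using (mem_outNbrs.1 (by simpa [layer] using hx)).2
  | succ r ih =>
    rcases mem_union.1 hx with hx | hx
    · obtain ⟨y, hy, h⟩ := ih hx
      exact ⟨y, union_subset_union_right (layer_mono S r.le_succ) hy, h⟩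
    · exact (mem_outNbrs.1 hx).2

/-- The set `T ∪ N(T)` induces a connected subgraph if `|N(T)| ≤ 1`. -/
theorem exists_adj_of_thin (hG : G.Connected) {T Y : Finset V} (hT : #(bdry G T) ≤ 1)
    (hY : Y.Nonempty) (hYX : Y ⊂ T ∪ bdry G T) :
    ∃ y ∈ Y, ∃ x ∈ (T ∪ bdry G T) \ Y, G.Adj y x := by
  obtain ⟨hsub, hne⟩ := Finset.ssubset_iff_subset_ne.1 hYX
  have hN : ∀ t ∈ T, ∀ z, G.Adj t z → z ∈ T ∪ bdry G T := fun t ht z h => by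
    by_cases hz : z ∈ T
    · exact mem_union_left _ hz
    · exact mem_union_right _ (mem_outNbrs.2 ⟨hz, t, ht, h⟩)
  by_cases hw : bdry G T ⊆ Y
  · have hZ : ((T ∪ bdry G T) \ Y).Nonempty := sdiff_nonempty.2 fun h => hne (hsub.antisymm h)
    obtain ⟨y0, hy0⟩ := hY
    obtain ⟨z', hz'⟩ := bdry_nonempty hG hZ fun h => by
      have := h ▸ mem_univ y0
      exact (mem_sdiff.1 this).2 hy0
    obtain ⟨h1, z, hz, hzz⟩ := mem_outNbrs.1 hz'
    obtain ⟨hzX, hzY⟩ := mem_sdiff.1 hz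
    have hzT : z ∈ T := (mem_union.1 hzX).resolve_right fun h => hzY (hw h)
    have hz'X := hN z hzT z' hzz
    refine ⟨z', ?_, z, hz, hzz.symm⟩
    by_contra h
    exact h1 (mem_sdiff.2 ⟨hz'X, h⟩)
  · obtain ⟨w, hwT, hwY⟩ := not_subset.1 hw
    have hYT : ∀ y ∈ Y, y ∈ T := fun y hy => (mem_union.1 (hsub hy)).resolve_right fun h => by
      rw [card_le_one.1 hT y h w hwT] at hy
      exact hwY hy
    obtain ⟨z, hz⟩ := bdry_nonempty hG hY fun h => hwY (h ▸ mem_univ w)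
    obtain ⟨hzY, y, hy, hyz⟩ := mem_outNbrs.1 hz
    exact ⟨y, hy, z, mem_sdiff.2 ⟨hN y (hYT y hy) z hyz, hzY⟩, hyz⟩

theorem sdiff_subset_layer (hG : G.Connected) {S T : Finset V} (hS : S.Nonempty) (hST : S ⊆ T)
    (hT : #(bdry G T) ≤ 1) : T \ S ⊆ layer G S (#(T \ S) + 1) := by
  set X := T ∪ bdry G T with hX
  have hgrow : ∀ r, r ≤ #(X \ S) → r ≤ #(X ∩ layer G S r) := by
    intro r
    induction r with
    | zero => simp
    | succ r ih =>
      intro hr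
      have h1 := ih (by omega)
      have hmono : X ∩ layer G S r ⊆ X ∩ layer G S (r + 1) :=
        inter_subset_inter_left (layer_mono S r.le_succ)
      by_contra hlt
      have heq : X ∩ layer G S r = X ∩ layer G S (r + 1) :=
        eq_of_subset_of_card_le hmono (by omega)
      have hYX : S ∪ (X ∩ layer G S r) ⊂ X := by
        refine Finset.ssubset_iff_subset_ne.2
          ⟨union_subset (hST.trans subset_union_left) inter_subset_left, fun h => ?_⟩
        have h2 : X \ S ⊆ X ∩ layer G S r := fun x hx => by
          obtain ⟨hxX, hxS⟩ := mem_sdiff.1 hx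
          rw [← h] at hxX
          exact (mem_union.1 hxX).resolve_left hxS
        have := card_le_card h2
        rw [heq] at this
        omega
      obtain ⟨y, hy, x, hx, hyx⟩ := exists_adj_of_thin hG hT (hS.mono subset_union_left) hYX
      obtain ⟨hxX, hxY⟩ := mem_sdiff.1 hx
      refine hxY (mem_union_right _ (heq ▸ mem_inter.2 ⟨hxX, mem_union_right _ (mem_outNbrs.2
        ⟨fun h => hxY (mem_union_left _ h), y, ?_, hyx⟩)⟩))
      rcases mem_union.1 hy with hy | hy
      · exact mem_union_left _ hy
      · exact mem_union_right _ (mem_inter.1 hy).2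
  have hfull : X \ S ⊆ layer G S (#(X \ S)) := by
    have hsub : X ∩ layer G S (#(X \ S)) ⊆ X \ S := fun x hx =>
      mem_sdiff.2 ⟨(mem_inter.1 hx).1, fun h =>
        disjoint_left.1 (disjoint_layer S _) h (mem_inter.1 hx).2⟩
    rw [← eq_of_subset_of_card_le hsub (hgrow _ le_rfl)]
    exact inter_subset_right.trans (by rw [eq_of_subset_of_card_le hsub (hgrow _ le_rfl)])
  have hcard : #(X \ S) ≤ #(T \ S) + 1 := by
    rw [hX, union_sdiff_distrib]
    exact (card_union_le _ _).trans
      (Nat.add_le_add_left ((card_le_card sdiff_subset).trans hT) _)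
  exact (sdiff_subset_sdiff subset_union_left Subset.rfl).trans
    (hfull.trans (layer_mono S hcard))

/-- In a completion of small excess the next vertex is near `S`. -/
theorem Completable.mem_layer (hG : G.Connected) {S : Finset V} (hS : S.Nonempty) {v : V}
    (hv : v ∉ S) {b : ℕ} (h : Completable G (insert v S) b) :
    v ∈ layer G S (b + (#(bdry G (insert v S)) - 1) + 2) := by
  obtain ⟨T, hST, hT, hcard⟩ := h.exists_thin
  have hvT : v ∈ T := hST (mem_insert_self _ _)
  have h1 := card_sdiff_of_subset hST
  have h2 := card_sdiff_of_subset ((subset_insert _ _).trans hST)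
  have h3 := card_insert_of_notMem hv
  exact layer_mono S (by omega)
    (sdiff_subset_layer hG hS ((subset_insert _ _).trans hST) hT (mem_sdiff.2 ⟨hvT, hv⟩))

open Classical in
/-- The neighbours of `x`, those in `S` counted twice. -/
noncomputable def weightedDegree (G : SimpleGraph V) (S : Finset V) (x : V) : ℕ :=
  ∑ y, if G.Adj x y then (if y ∈ S then 1 else 0) + 1 else 0

/-- `x` has at most one neighbour, and none in `S`. -/
def Pendant (G : SimpleGraph V) (S : Finset V) (x : V) : Prop :=
  weightedDegree G S x ≤ 1

theorem pendant_iff {S : Finset V} {x : V} :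
    Pendant G S x ↔ (∀ y z, G.Adj x y → G.Adj x z → y = z) ∧ ∀ y ∈ S, ¬ G.Adj x y := by
  classical
  unfold Pendant weightedDegree
  constructor
  · intro h
    constructor
    · intro y z hy hz
      by_contra hyz
      have := sum_le_sum_of_subset (f := fun y => if G.Adj x y then (if y ∈ S then 1 else 0) + 1
        else 0) (subset_univ {y, z})
      rw [sum_pair hyz] at this
      simp only [hy, hz, if_true] at this
      omega
    · intro y hy hxy
      have := single_le_sum (f := fun y => if G.Adj x y then (if y ∈ S then 1 else 0) + 1
        else 0) (fun _ _ => Nat.zero_le _) (mem_univ y)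
      simp only [hy, hxy, if_true] at this
      omega
  · rintro ⟨h1, h2⟩
    by_cases hx : ∃ y, G.Adj x y
    · obtain ⟨y, hy⟩ := hx
      rw [sum_eq_single y]
      · have : y ∉ S := fun h => h2 y h hy
        simp [hy, this]
      · intro z _ hzy
        rw [if_neg fun hz => hzy (h1 z y hz hy)]
      · simp
    · rw [sum_eq_zero]
      · omega
      · intro y _
        rw [if_neg fun hy => hx ⟨y, hy⟩]

open Classical in
/-- The vertices outside `S` with a neighbour in `C` that are not pendant. -/
noncomputable def innerNbrs (G : SimpleGraph V) (S C : Finset V) : Finset V :=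
  (outNbrs G S C).filter fun x => ¬ Pendant G S x

theorem mem_innerNbrs {S C : Finset V} {x : V} :
    x ∈ innerNbrs G S C ↔ x ∈ outNbrs G S C ∧ ¬ Pendant G S x := by
  simp [innerNbrs]

open Classical in
/-- The neighbours of `u` outside `S` that have another neighbour. -/
noncomputable def branchNbrs (G : SimpleGraph V) (S : Finset V) (u : V) : Finset V :=
  univ.filter fun x => x ∉ S ∧ G.Adj u x ∧ ∃ z, z ≠ u ∧ G.Adj x z

theorem mem_branchNbrs {S : Finset V} {u x : V} :
    x ∈ branchNbrs G S u ↔ x ∉ S ∧ G.Adj u x ∧ ∃ z, z ≠ u ∧ G.Adj x z := by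
  simp [branchNbrs]

theorem card_branchNbrs_le_insert (S : Finset V) (u x : V) :
    #(branchNbrs G S u) ≤ #(branchNbrs G (insert x S) u) + 1 := by
  refine (card_le_card (t := insert x (branchNbrs G (insert x S) u)) fun y hy => ?_).trans
    (card_insert_le _ _)
  obtain ⟨h1, h2⟩ := mem_branchNbrs.1 hy
  by_cases hyx : y = x
  · simp [hyx]
  · exact mem_insert_of_mem (mem_branchNbrs.2 ⟨by simp [h1, hyx], h2⟩)

theorem card_branchNbrs_le_bdry (S : Finset V) (u : V) :
    #(branchNbrs G S u) ≤ #(bdry G (insert u S)) := by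
  refine card_le_card fun y hy => ?_
  obtain ⟨h1, h2, -⟩ := mem_branchNbrs.1 hy
  exact mem_outNbrs.2 ⟨by simp [h1, h2.ne'], u, mem_insert_self _ _, h2⟩

/-- While `u` is the only boundary vertex before and after an addition, the vertex added is a leaf
at `u`; every other neighbour of `u` with a further neighbour costs excess. -/
theorem Completable.card_branchNbrs_le_of_mem {S : Finset V} {b : ℕ} (h : Completable G S b)
    {u : V} (hu : u ∈ bdry G S) : #(branchNbrs G S u) ≤ 2 * b + 2 + min 1 (#(bdry G S) - 1) := by
  induction h with
  | full b => simp [bdry_univ] at hu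
  | @step S x b c hx h hc ih =>
    obtain ⟨huS, y, hy, hyu⟩ := mem_outNbrs.1 hu
    by_cases hxu : x = u
    · subst hxu
      have := card_branchNbrs_le_bdry (G := G) S x
      omega
    have hu' : u ∈ bdry G (insert x S) :=
      mem_outNbrs.2 ⟨by simp [huS, Ne.symm hxu], y, mem_insert_of_mem hy, hyu⟩
    have h1 := ih hu'
    have h2 := card_branchNbrs_le_insert (G := G) S u x
    by_cases hthin : #(bdry G S) ≤ 1 ∧ #(bdry G (insert x S)) ≤ 1
    · have h3 : branchNbrs G S u ⊆ branchNbrs G (insert x S) u := by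
        intro z hz
        obtain ⟨hz1, hz2, w, hwu, hzw⟩ := mem_branchNbrs.1 hz
        refine mem_branchNbrs.2 ⟨fun hzx => ?_, hz2, w, hwu, hzw⟩
        obtain rfl : z = x := (mem_insert.1 hzx).resolve_right hz1
        by_cases hwS : w ∈ S
        · have hzN : z ∈ bdry G S := mem_outNbrs.2 ⟨hz1, w, hwS, hzw.symm⟩
          exact hxu (card_le_one.1 hthin.1 z hzN u hu)
        · have hwN : w ∈ bdry G (insert z S) :=
            mem_outNbrs.2 ⟨by simp [hwS, hzw.ne'], z, mem_insert_self _ _, hzw⟩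
          exact hwu (card_le_one.1 hthin.2 w hwN u hu')
      have := card_le_card h3
      omega
    · omega

/-- Outside `S`, every vertex has few neighbours that have another neighbour. -/
theorem Completable.card_branchNbrs_le {S : Finset V} {b : ℕ} (h : Completable G S b)
    {u : V} (hu : u ∉ S) : #(branchNbrs G S u) ≤ 2 * b + 3 := by
  induction h with
  | full b => simp at hu
  | @step S x b c hx h hc ih =>
    by_cases hxu : x = u
    · subst hxu
      have := card_branchNbrs_le_bdry (G := G) S x
      omega
    have hu' : u ∉ insert x S := by simp [hu, Ne.symm hxu]
    by_cases hadj : G.Adj x u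
    · have h1 := h.card_branchNbrs_le_of_mem
        (mem_outNbrs.2 ⟨hu', x, mem_insert_self _ _, hadj⟩)
      have h2 := card_branchNbrs_le_insert (G := G) S u x
      omega
    · have h3 : branchNbrs G S u ⊆ branchNbrs G (insert x S) u := by
        intro z hz
        obtain ⟨hz1, hz2, hz3⟩ := mem_branchNbrs.1 hz
        refine mem_branchNbrs.2 ⟨fun hzx => ?_, hz2, hz3⟩
        rcases mem_insert.1 hzx with rfl | hzS
        · exact hadj hz2.symm
        · exact hz1 hzS
      have := card_le_card h3
      have := ih hu'
      omega

theorem Completable.card_innerNbrs_singleton_le {S : Finset V} {b : ℕ} (h : Completable G S b)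
    {u : V} (hu : u ∉ S) : #(innerNbrs G S {u}) ≤ 2 * b + 3 := by
  refine (card_le_card fun x hx => ?_).trans (h.card_branchNbrs_le hu)
  simp only [innerNbrs, mem_filter, mem_outNbrs, mem_singleton, exists_eq_left, pendant_iff] at hx
  obtain ⟨⟨hxS, hux⟩, hnp⟩ := hx
  refine mem_branchNbrs.2 ⟨hxS, hux, ?_⟩
  by_contra! hz
  have hz' : ∀ z, G.Adj x z → z = u := fun z hxz => by
    by_contra hne
    exact hz z hne hxz
  refine hnp ⟨fun y z hy hz => (hz' y hy).trans (hz' z hz).symm, fun y hy hxy => hu ?_⟩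
  rwa [← hz' y hxy]

theorem card_innerNbrs_self_le (S : Finset V) (v : V) :
    #(innerNbrs G S S) ≤ #(bdry G (insert v S)) + 1 := by
  refine (card_le_card (t := insert v (bdry G (insert v S))) fun x hx => ?_).trans
    (card_insert_le _ _)
  simp only [innerNbrs, mem_filter, mem_outNbrs] at hx
  obtain ⟨⟨hxS, y, hy, hyx⟩, -⟩ := hx
  by_cases hxv : x = v
  · simp [hxv]
  · exact mem_insert_of_mem (mem_outNbrs.2 ⟨by simp [hxS, hxv], y, mem_insert_of_mem hy, hyx⟩)

theorem Completable.image_iso (φ : G ≃g G) {S : Finset V} {b : ℕ} (h : Completable G S b) :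
    Completable G (S.image φ) b := by
  have hb : ∀ S : Finset V, #(bdry G (S.image φ)) = #(bdry G S) := fun S => by
    rw [← card_image_of_injective (bdry G S) φ.injective]
    congr 1
    ext x
    obtain ⟨x, rfl⟩ := φ.surjective x
    simp [mem_outNbrs, φ.injective.eq_iff, φ.map_adj_iff]
  induction h with
  | full b => rw [image_univ_of_surjective φ.surjective]; exact .full b
  | @step S x b c hx h hc ih =>
    rw [image_insert] at ih
    refine .step (by simpa [φ.injective.eq_iff] using hx) ih ?_
    rw [← image_insert, hb]
    exact hc

/-- Two pendant neighbours of the same vertex outside `S` are interchangeable. -/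
theorem Completable.insert_twin {S : Finset V} {x y u : V} (hx : Pendant G S x)
    (hy : Pendant G S y) (hux : G.Adj u x) (huy : G.Adj u y) (hxS : x ∉ S) (hyS : y ∉ S) {b : ℕ}
    (h : Completable G (insert x S) b) :
    Completable G (insert y S) b ∧ #(bdry G (insert y S)) = #(bdry G (insert x S)) := by
  rw [pendant_iff] at hx hy
  have hx' : ∀ z, G.Adj x z ↔ z = u := fun z =>
    ⟨fun h => hx.1 z u h hux.symm, fun h => h ▸ hux.symm⟩
  have hy' : ∀ z, G.Adj y z ↔ z = u := fun z =>
    ⟨fun h => hy.1 z u h huy.symm, fun h => h ▸ huy.symm⟩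
  have hτu : Equiv.swap x y u = u := Equiv.swap_apply_of_ne_of_ne hux.ne huy.ne
  have hleaf : ∀ c, G.Adj x c ∨ G.Adj y c → c = u := fun c h =>
    h.elim (hx' c).1 (hy' c).1
  have hmap : ∀ a c, G.Adj a c → G.Adj (Equiv.swap x y a) (Equiv.swap x y c) := by
    intro a c hac
    by_cases ha : a = x ∨ a = y
    · obtain rfl : c = u := hleaf c (by rcases ha with rfl | rfl <;> simp [hac])
      rw [hτu]
      rcases ha with rfl | rfl
      · rw [Equiv.swap_apply_left]; exact huy.symm
      · rw [Equiv.swap_apply_right]; exact hux.symm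
    by_cases hc : c = x ∨ c = y
    · obtain rfl : a = u := hleaf a (by rcases hc with rfl | rfl <;> simp [hac.symm])
      rw [hτu]
      rcases hc with rfl | rfl
      · rw [Equiv.swap_apply_left]; exact huy
      · rw [Equiv.swap_apply_right]; exact hux
    rw [not_or] at ha hc
    rwa [Equiv.swap_apply_of_ne_of_ne ha.1 ha.2, Equiv.swap_apply_of_ne_of_ne hc.1 hc.2]
  let φ : G ≃g G :=
    { Equiv.swap x y with
      map_rel_iff' := fun {a c} => ⟨fun h => by simpa using hmap _ _ h, hmap a c⟩ }
  have himg : (insert x S).image φ = insert y S := by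
    have hφx : φ x = y := Equiv.swap_apply_left x y
    rw [image_insert, hφx]
    congr 1
    conv_rhs => rw [← image_id (s := S)]
    refine image_congr fun z hz => ?_
    have h1 : z ≠ x := fun h => hxS (h ▸ hz)
    have h2 : z ≠ y := fun h => hyS (h ▸ hz)
    exact Equiv.swap_apply_of_ne_of_ne h1 h2
  refine ⟨himg ▸ h.image_iso φ, ?_⟩
  rw [← himg, ← card_image_of_injective (bdry G (insert x S)) φ.injective]
  congr 1
  ext z
  obtain ⟨z, rfl⟩ := φ.surjective z
  simp [mem_outNbrs, φ.injective.eq_iff, φ.map_adj_iff]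

end Combinatorics

/-! ### Profiles as sums of boundary sizes -/

section Ordering

variable {V : Type*} [Fintype V] [DecidableEq V] {G : SimpleGraph V}

/-- The set of the first `j` vertices of an ordering. -/
def initialSet (α : VertexOrdering V) (j : ℕ) : Finset V :=
  univ.filter fun v => (α v : ℕ) < j

/-- The vertex `v` is in the boundary of the set of the first `i + 1` vertices precisely for the
`α v - min α(N[v])` values of `i` with `min α(N[v]) ≤ i < α v`. -/
theorem orderingProfile_eq_sum (α : VertexOrdering V) :
    orderingProfile G α = ∑ i ∈ range (Fintype.card V), #(bdry G (initialSet α (i + 1))) := by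
  have h : ∀ v, vertexProfile G α v =
      ∑ i ∈ range (Fintype.card V), if v ∈ bdry G (initialSet α (i + 1)) then 1 else 0 := by
    intro v
    rw [← card_filter, vertexProfile, ← Nat.card_Ico]
    congr 1
    ext i
    have hv := (α v).2
    rw [mem_filter, mem_range]
    simp only [mem_Ico, inf'_le_iff, closedNbhd, mem_filter, mem_univ, true_and,
      mem_outNbrs, initialSet]
    constructor
    · rintro ⟨⟨u, hu, hui⟩, hiv⟩
      refine ⟨by omega, by omega, u, by omega, ?_⟩
      rcases hu with rfl | hu
      · omega
      · exact hu.symm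
    · rintro ⟨-, h1, u, h2, h3⟩
      exact ⟨⟨u, Or.inr h3.symm, by omega⟩, by omega⟩
  rw [orderingProfile, sum_congr rfl fun v _ => h v, sum_comm]
  refine sum_congr rfl fun i _ => ?_
  rw [← card_filter]
  congr 1
  ext v
  simp

theorem completable_initialSet (α : VertexOrdering V) (d : ℕ) : ∀ j, j + d = Fintype.card V →
    Completable G (initialSet α j)
      (∑ i ∈ Ico j (Fintype.card V), (#(bdry G (initialSet α (i + 1))) - 1)) := by
  induction d with
  | zero =>
    intro j hj
    have : initialSet α j = univ := by
      ext v
      have := (α v).2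
      simp only [initialSet, mem_filter, mem_univ, true_and, iff_true]
      omega
    rw [this]
    exact .full _
  | succ d ih =>
    intro j hj
    have hjn : j < Fintype.card V := by omega
    have hins : insert (α.symm ⟨j, hjn⟩) (initialSet α j) = initialSet α (j + 1) := by
      ext v
      simp only [initialSet, mem_insert, mem_filter, mem_univ, true_and, Equiv.eq_symm_apply,
        Fin.ext_iff]
      omega
    have h := ih (j + 1) (by omega)
    rw [sum_eq_sum_Ico_succ_bot hjn]
    rw [← hins] at h
    refine .step (by simp [initialSet]) h ?_
    rw [hins]
    omega

theorem completable_of_orderingProfile_le (hG : G.Connected) (α : VertexOrdering V) {k : ℕ}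
    (h : orderingProfile G α ≤ Fintype.card V - 1 + k) : Completable G ∅ k := by
  have h0 := completable_initialSet (G := G) α (Fintype.card V) 0 (by omega)
  have hempty : initialSet α 0 = ∅ := by simp [initialSet]
  rw [hempty] at h0
  refine h0.mono ?_
  rw [orderingProfile_eq_sum] at h
  obtain ⟨p, hp⟩ : ∃ p, Fintype.card V = p + 1 :=
    Nat.exists_eq_succ_of_ne_zero (have := hG.nonempty; Fintype.card_ne_zero)
  have hfull : initialSet α (p + 1) = univ := by
    ext v
    have := (α v).2
    simp only [initialSet, mem_filter, mem_univ, true_and, iff_true]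
    omega
  have hpos : ∀ i ∈ range p, #(bdry G (initialSet α (i + 1))) - 1 + 1 ≤
      #(bdry G (initialSet α (i + 1))) := by
    intro i hi
    rw [mem_range] at hi
    have : (bdry G (initialSet α (i + 1))).Nonempty := by
      refine bdry_nonempty hG ⟨α.symm ⟨0, by omega⟩, by simp [initialSet]⟩ fun h => ?_
      have hm := mem_univ (α.symm ⟨p, by omega⟩)
      rw [← h] at hm
      simp only [initialSet, mem_filter, mem_univ, true_and, Equiv.apply_symm_apply] at hm
      omega
    have := card_pos.2 this
    omega
  have hsum := sum_le_sum hpos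
  rw [sum_add_distrib, sum_const, card_range, smul_eq_mul, mul_one] at hsum
  rw [hp, sum_range_succ, hfull, bdry_univ, card_empty] at h
  rw [hp, Nat.Ico_zero_eq_range, sum_range_succ, hfull, bdry_univ, card_empty]
  omega

/-- The sum of `|N(S)|` over the nonempty prefixes `S` of a list of vertices. -/
noncomputable def prefixCost (G : SimpleGraph V) (l : List V) : ℕ :=
  ∑ i ∈ range l.length, #(bdry G (l.take (i + 1)).toFinset)

theorem prefixCost_append_singleton (l : List V) (v : V) :
    prefixCost G (l ++ [v]) = prefixCost G l + #(bdry G (insert v l.toFinset)) := by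
  rw [prefixCost, List.length_append, List.length_singleton, sum_range_succ, prefixCost]
  congr 1
  · refine sum_congr rfl fun i hi => ?_
    rw [mem_range] at hi
    rw [List.take_append_of_le_length (by omega)]
  · rw [List.take_of_length_le (by simp), List.toFinset_append]
    congr 2
    ext x
    simp

theorem exists_orderingProfile_eq {l : List V} (hl : l.Nodup) (hu : l.toFinset = univ) :
    ∃ α : VertexOrdering V, orderingProfile G α = prefixCost G l := by
  have hlen : l.length = Fintype.card V := by
    rw [← List.toFinset_card_of_nodup hl, hu, card_univ]
  have hmem : ∀ v, v ∈ l := fun v => by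
    rw [← List.mem_toFinset, hu]
    exact mem_univ v
  let β : Fin l.length ≃ V := hl.getEquivOfForallMemList l hmem
  have hβ : ∀ i, β i = l[i] := fun i => rfl
  let α : VertexOrdering V := β.symm.trans (finCongr hlen)
  refine ⟨α, ?_⟩
  rw [orderingProfile_eq_sum, prefixCost, hlen]
  refine sum_congr rfl fun i hi => ?_
  congr 2
  ext v
  have hα : l[(β.symm v : ℕ)] = v := by
    rw [← Fin.getElem_fin, ← hβ, Equiv.apply_symm_apply]
  have hαv : (α v : ℕ) = (β.symm v : ℕ) := rfl
  simp only [initialSet, mem_filter, mem_univ, true_and, hαv, List.mem_toFinset,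
    List.mem_take_iff_getElem]
  constructor
  · intro h
    exact ⟨β.symm v, by have := (β.symm v).2; omega, hα⟩
  · rintro ⟨j, hj, rfl⟩
    have : β.symm l[j] = ⟨j, by omega⟩ := by
      rw [Equiv.symm_apply_eq]; rfl
    rw [this]
    simp only
    omega

end Ordering

/-! ### The guided greedy search -/

section Search

variable {n : ℕ} {G : SimpleGraph (Fin n)}

open Classical in
/-- The last vertex below `j` that satisfies `P`, or `a` if there is none. -/
noncomputable def lastSat (P : Fin n → Prop) (a : Fin n) : ℕ → Fin n
  | 0 => a
  | j + 1 => if h : ∃ hj : j < n, P ⟨j, hj⟩ then ⟨j, h.1⟩ else lastSat P a j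

theorem lastSat_spec {P : Fin n → Prop} {a : Fin n} {j : ℕ} (h : ∃ x, P x ∧ x.1 < j) :
    P (lastSat P a j) := by
  induction j with
  | zero => simp at h
  | succ j ih =>
    rw [lastSat]
    split_ifs with hj
    · exact hj.2
    · obtain ⟨x, hx, hxj⟩ := h
      refine ih ⟨x, hx, ?_⟩
      by_contra hlt
      have : x.1 = j := by omega
      subst this
      exact hj ⟨x.2, hx⟩

/-- The vertices `x` outside `S` with a neighbour in `C` that the digit `d` points at. All pendant
vertices have the digit `1`, the others have different digits, from `2` on. -/
def PointsAt (G : SimpleGraph (Fin n)) (S C : Finset (Fin n)) (d : ℕ) (x : Fin n) : Prop :=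
  x ∈ outNbrs G S C ∧
    ((Pendant G S x ∧ d = 1) ∨ (¬ Pendant G S x ∧ d = 2 + #{y ∈ innerNbrs G S C | y.1 < x.1}))

/-- The state of a walk outside a vertex set: the set that the next vertex has to be adjacent to,
the last vertex, and the number whose digits guide the remaining walk. -/
structure Walker (n : ℕ) where
  source : Finset (Fin n)
  last : Fin n
  code : ℕ

open Classical in
/-- One step of a walk, guided by the lowest digit of the code in base `B`. The digit `0` means no
move. -/
noncomputable def walkStep (G : SimpleGraph (Fin n)) (S : Finset (Fin n)) (B : ℕ) (w : Walker n) :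
    Walker n :=
  if w.code % B = 0 then ⟨w.source, w.last, w.code / B⟩
  else
    let x := lastSat (PointsAt G S w.source (w.code % B)) w.last n
    ⟨{x}, x, w.code / B⟩

/-- `v ∉ S`, and its addition to `S` leaves a boundary of size at most one. -/
def ThinAt (G : SimpleGraph (Fin n)) (S : Finset (Fin n)) (v : Fin n) : Prop :=
  v ∉ S ∧ #(bdry G (insert v S)) ≤ 1

/-- The state of the search: the set of vertices ordered so far, the sum of the boundary sizes, and
the number whose digits guide the remaining search. -/
structure Search (n : ℕ) where
  done : Finset (Fin n)
  cost : ℕ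
  code : ℕ

open Classical in
/-- The vertex that the search adds next and the remaining code: greedily a vertex that leaves a
boundary of size at most one, otherwise the end of a walk of `r` steps that starts at `S`. -/
noncomputable def nextVertex (G : SimpleGraph (Fin n)) (B r : ℕ) (a : Fin n) (S : Finset (Fin n))
    (m : ℕ) : Fin n × ℕ :=
  if ∃ v, ThinAt G S v then (lastSat (ThinAt G S) a n, m)
  else (((walkStep G S B)^[r] ⟨S, a, m⟩).last, ((walkStep G S B)^[r] ⟨S, a, m⟩).code)

noncomputable def searchStep (G : SimpleGraph (Fin n)) (B r : ℕ) (a : Fin n) (s : Search n) :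
    Search n :=
  let v := nextVertex G B r a s.done s.code
  ⟨insert v.1 s.done, s.cost + #(bdry G (insert v.1 s.done)), v.2⟩

/-- The start of the search, with first vertex `a`. -/
noncomputable def searchInit (G : SimpleGraph (Fin n)) (a : Fin n) (m : ℕ) : Search n :=
  ⟨{a}, #(bdry G {a}), m⟩

/-- A step of the search that meets a vertex of the set again adds nothing and does not lower the
cost. -/
theorem searchStep_sound (B r : ℕ) (a : Fin n) {s : Search n}
    (h : ∃ l : List (Fin n), l.Nodup ∧ l.toFinset = s.done ∧ prefixCost G l ≤ s.cost) :
    ∃ l : List (Fin n), l.Nodup ∧ l.toFinset = (searchStep G B r a s).done ∧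
      prefixCost G l ≤ (searchStep G B r a s).cost := by
  obtain ⟨l, hl, hS, hc⟩ := h
  simp only [searchStep]
  generalize (nextVertex G B r a s.done s.code).1 = v
  by_cases hv : v ∈ s.done
  · rw [insert_eq_of_mem hv]
    exact ⟨l, hl, hS, by omega⟩
  · refine ⟨l ++ [v], ?_, ?_, ?_⟩
    · rw [← hS, List.mem_toFinset] at hv
      simpa [List.nodup_append, hl] using fun x hx (h : x = v) => hv (h ▸ hx)
    · rw [List.toFinset_append, hS]
      ext x
      simp
    · rw [prefixCost_append_singleton, hS]
      omega

/-- Whatever the code is, a run that ends with all vertices yields an ordering. -/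
theorem search_sound (B r : ℕ) (a : Fin n) (m i : ℕ) {c : ℕ}
    (hfull : ((searchStep G B r a)^[i] (searchInit G a m)).done = univ)
    (hc : ((searchStep G B r a)^[i] (searchInit G a m)).cost ≤ c) :
    ∃ α : VertexOrdering (Fin n), orderingProfile G α ≤ c := by
  have h : ∀ i, ∃ l : List (Fin n), l.Nodup ∧
      l.toFinset = ((searchStep G B r a)^[i] (searchInit G a m)).done ∧
      prefixCost G l ≤ ((searchStep G B r a)^[i] (searchInit G a m)).cost := by
    intro i
    induction i with
    | zero => exact ⟨[a], by simp, by simp [searchInit], by simp [prefixCost, searchInit]⟩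
    | succ i ih =>
      rw [Function.iterate_succ_apply']
      exact searchStep_sound B r a ih
  obtain ⟨l, hl, hu, hl'⟩ := h i
  obtain ⟨α, hα⟩ := exists_orderingProfile_eq (G := G) hl (hu.trans hfull)
  exact ⟨α, by omega⟩

theorem walkStep_zero {S : Finset (Fin n)} {B : ℕ} (hB : 0 < B) (C : Finset (Fin n)) (a : Fin n)
    (m : ℕ) : walkStep G S B ⟨C, a, 0 + B * m⟩ = ⟨C, a, m⟩ := by
  simp [walkStep, Nat.mul_div_cancel_left m hB]

theorem walkStep_digit {S : Finset (Fin n)} {B : ℕ} {d : ℕ} (hd : 0 < d) (hdB : d < B)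
    (C : Finset (Fin n)) (a : Fin n) (m : ℕ) :
    walkStep G S B ⟨C, a, d + B * m⟩ =
      ⟨{lastSat (PointsAt G S C d) a n}, lastSat (PointsAt G S C d) a n, m⟩ := by
  have h1 : (d + B * m) % B = d := by
    rw [Nat.add_mul_mod_self_left, Nat.mod_eq_of_lt hdB]
  have h2 : (d + B * m) / B = m := by
    rw [Nat.add_mul_div_left _ _ (by omega), Nat.div_eq_of_lt hdB, zero_add]
  simp only [walkStep, h1, h2]
  rw [if_neg (by omega)]

theorem iterate_walkStep_zero {S : Finset (Fin n)} {B : ℕ} (hB : 0 < B) (a : Fin n) (r m : ℕ) :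
    (walkStep G S B)^[r] ⟨S, a, 0 + B ^ r * m⟩ = ⟨S, a, m⟩ := by
  induction r generalizing m with
  | zero => simp
  | succ r ih =>
    rw [Function.iterate_succ_apply', pow_succ, mul_assoc]
    have h1 := ih (B * m)
    have h2 := walkStep_zero (G := G) (S := S) hB S a m
    rw [h1]
    simpa using h2

theorem lastSat_pointsAt {S C : Finset (Fin n)} {x : Fin n} (hx : x ∈ outNbrs G S C)
    (hp : ¬ Pendant G S x) (a : Fin n) :
    lastSat (PointsAt G S C (2 + #{y ∈ innerNbrs G S C | y.1 < x.1})) a n = x := by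
  obtain ⟨h1, h2⟩ := lastSat_spec
    (P := PointsAt G S C (2 + #{y ∈ innerNbrs G S C | y.1 < x.1})) (a := a)
    ⟨x, ⟨hx, Or.inr ⟨hp, rfl⟩⟩, x.2⟩
  generalize lastSat (PointsAt G S C (2 + #{y ∈ innerNbrs G S C | y.1 < x.1})) a n = z at h1 h2
  rcases h2 with ⟨-, h2⟩ | ⟨hz, h2⟩
  · omega
  have hmem : ∀ w, w ∈ outNbrs G S C → ¬ Pendant G S w → w ∈ innerNbrs G S C := fun w h h' =>
    mem_innerNbrs.2 ⟨h, h'⟩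
  -- The number of smaller elements determines an element of a finite set.
  have hlt : ∀ w w' : Fin n, w ∈ innerNbrs G S C → w.1 < w'.1 →
      #{y ∈ innerNbrs G S C | y.1 < w.1} < #{y ∈ innerNbrs G S C | y.1 < w'.1} := by
    intro w w' hw hww
    refine card_lt_card ((ssubset_iff_of_subset ?_).2 ⟨w, mem_filter.2 ⟨hw, hww⟩, by simp⟩)
    intro y
    simp only [mem_filter]
    exact fun h => ⟨h.1, h.2.trans hww⟩
  rcases lt_trichotomy z.1 x.1 with h | h | h
  · have := hlt z x (hmem z h1 hz) h
    omega
  · exact Fin.ext h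
  · have := hlt x z (hmem x hx hp) h
    omega

/-- A digit below `B` leads to any given vertex that is not pendant. -/
theorem exists_digit {S C : Finset (Fin n)} {x : Fin n} (hx : x ∈ outNbrs G S C)
    (hp : ¬ Pendant G S x) {B : ℕ} (hB : #(innerNbrs G S C) + 2 ≤ B) :
    ∃ d, d < B ∧ ∀ a m, walkStep G S B ⟨C, a, d + B * m⟩ = ⟨{x}, x, m⟩ := by
  have hlt : #{y ∈ innerNbrs G S C | y.1 < x.1} < #(innerNbrs G S C) := by
    refine card_lt_card ((ssubset_iff_of_subset (filter_subset _ _)).2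
      ⟨x, mem_innerNbrs.2 ⟨hx, hp⟩, by simp⟩)
  refine ⟨2 + #{y ∈ innerNbrs G S C | y.1 < x.1}, by omega, fun a m => ?_⟩
  rw [walkStep_digit (by omega) (by omega), lastSat_pointsAt hx hp]

theorem iterate_walkStep_succ {S : Finset (Fin n)} {B r m₀ d : ℕ} {a : Fin n} {w w' : Walker n}
    (h : ∀ m, (walkStep G S B)^[r] ⟨S, a, m₀ + B ^ r * m⟩ = ⟨w.source, w.last, m⟩)
    (h' : ∀ m, walkStep G S B ⟨w.source, w.last, d + B * m⟩ = ⟨w'.source, w'.last, m⟩) (m : ℕ) :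
    (walkStep G S B)^[r + 1] ⟨S, a, (m₀ + B ^ r * d) + B ^ (r + 1) * m⟩ =
      ⟨w'.source, w'.last, m⟩ := by
  have : m₀ + B ^ r * d + B ^ (r + 1) * m = m₀ + B ^ r * (d + B * m) := by ring
  rw [this, Function.iterate_succ_apply', h, h']

theorem add_pow_mul_lt {B r m₀ d : ℕ} (hm : m₀ < B ^ r) (hd : d < B) :
    m₀ + B ^ r * d < B ^ (r + 1) := by
  calc m₀ + B ^ r * d < B ^ r * (d + 1) := by rw [mul_add, mul_one]; omega
    _ ≤ B ^ r * B := Nat.mul_le_mul_left _ hd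
    _ = B ^ (r + 1) := (pow_succ _ _).symm

/-- A walk of `r` steps reaches every vertex of the `r`-th layer that is not pendant. The inner
vertices of a shortest path are not pendant. -/
theorem exists_walk {S : Finset (Fin n)} {B : ℕ} (hS : #(innerNbrs G S S) + 2 ≤ B)
    (hB : ∀ u ∉ S, #(innerNbrs G S {u}) + 2 ≤ B) (a : Fin n) (r : ℕ) :
    ∀ x ∈ layer G S r, ¬ Pendant G S x → ∃ m₀ < B ^ r, ∀ m,
      (walkStep G S B)^[r] ⟨S, a, m₀ + B ^ r * m⟩ = ⟨{x}, x, m⟩ := by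
  induction r with
  | zero => simp [layer]
  | succ r ih =>
    have hB0 : 0 < B := by omega
    have hstay : ∀ x ∈ layer G S r, ¬ Pendant G S x → ∃ m₀ < B ^ (r + 1), ∀ m,
        (walkStep G S B)^[r + 1] ⟨S, a, m₀ + B ^ (r + 1) * m⟩ = ⟨{x}, x, m⟩ := by
      intro x hx hp
      obtain ⟨m₀, hm₀, h⟩ := ih x hx hp
      exact ⟨m₀ + B ^ r * 0, add_pow_mul_lt hm₀ hB0,
        iterate_walkStep_succ (w := ⟨{x}, x, 0⟩) (w' := ⟨{x}, x, 0⟩) h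
          fun m => walkStep_zero hB0 _ _ _⟩
    intro x hx hp
    rcases mem_union.1 hx with hx | hx
    · exact hstay x hx hp
    obtain ⟨hxS, u, hu, hux⟩ := mem_outNbrs.1 hx
    rcases mem_union.1 hu with hu | hu
    · obtain ⟨d, hd, h⟩ := exists_digit (mem_outNbrs.2 ⟨hxS, u, hu, hux⟩) hp hS
      exact ⟨0 + B ^ r * d, add_pow_mul_lt (by positivity) hd,
        iterate_walkStep_succ (w := ⟨S, a, 0⟩) (w' := ⟨{x}, x, 0⟩)
          (iterate_walkStep_zero hB0 a r) (h a)⟩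
    have huS : u ∉ S := fun h => disjoint_left.1 (disjoint_layer S r) h hu
    by_cases hup : Pendant G S u
    · -- A pendant vertex of a layer has its only neighbour in an earlier layer.
      rw [pendant_iff] at hup
      obtain _ | r := r
      · simp [layer] at hu
      obtain ⟨y, hy, hyu⟩ := exists_adj_of_mem_layer_succ hu
      rcases mem_union.1 hy with hy | hy
      · exact absurd hyu.symm (hup.2 y hy)
      · obtain rfl := hup.1 x y hux hyu.symm
        exact hstay x (layer_mono S r.le_succ hy) hp
    · obtain ⟨m₀, hm₀, h⟩ := ih u hu hup
      obtain ⟨d, hd, h'⟩ := exists_digit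
        (mem_outNbrs.2 ⟨hxS, u, mem_singleton_self u, hux⟩) hp (hB u huS)
      exact ⟨m₀ + B ^ r * d, add_pow_mul_lt hm₀ hd,
        iterate_walkStep_succ (w := ⟨{u}, u, 0⟩) (w' := ⟨{x}, x, 0⟩) h (h' u)⟩

/-- Two adjacent pendant vertices form a component of their own. -/
theorem notMem_layer_of_pendant {S : Finset (Fin n)} (r : ℕ) : ∀ x y : Fin n, Pendant G S x →
    Pendant G S y → G.Adj x y → x ∉ layer G S r := by
  induction r with
  | zero => simp [layer]
  | succ r ih =>
    intro x y hx hy hxy h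
    obtain ⟨z, hz, hzx⟩ := exists_adj_of_mem_layer_succ h
    rw [pendant_iff] at hx
    rcases mem_union.1 hz with hz | hz
    · exact hx.2 z hz hzx.symm
    · obtain rfl := hx.1 z y hzx.symm hxy
      exact ih z x hy (pendant_iff.2 hx) hzx hz

/-- A walk of `r` steps reaches every pendant vertex of the `r`-th layer, up to twins. -/
theorem exists_walk_pendant {S : Finset (Fin n)} {B : ℕ} (hS : #(innerNbrs G S S) + 2 ≤ B)
    (hB : ∀ u ∉ S, #(innerNbrs G S {u}) + 2 ≤ B) (a : Fin n) {r : ℕ} {x : Fin n}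
    (hx : x ∈ layer G S r) (hp : Pendant G S x) : ∃ u y, Pendant G S y ∧
      G.Adj u x ∧ G.Adj u y ∧ y ∉ S ∧ ∃ m₀ < B ^ r, ∀ m,
      (walkStep G S B)^[r] ⟨S, a, m₀ + B ^ r * m⟩ = ⟨{y}, y, m⟩ := by
  obtain _ | r := r
  · simp [layer] at hx
  have hxS : x ∉ S := fun h => disjoint_left.1 (disjoint_layer S _) h hx
  obtain ⟨u, hu, hux⟩ := exists_adj_of_mem_layer_succ hx
  have huS : u ∉ S := fun h => (pendant_iff.1 hp).2 u h hux.symm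
  have hu := (mem_union.1 hu).resolve_left huS
  have hup : ¬ Pendant G S u := fun h => notMem_layer_of_pendant r u x h hp hux hu
  obtain ⟨m₀, hm₀, h⟩ := exists_walk hS hB a r u hu hup
  obtain ⟨hy, hy'⟩ := lastSat_spec (P := PointsAt G S {u} 1) (a := u) (j := n)
    ⟨x, ⟨mem_outNbrs.2 ⟨hxS, u, mem_singleton_self u, hux⟩, Or.inl ⟨hp, rfl⟩⟩, x.2⟩
  have h' := walkStep_digit (G := G) (S := S) (B := B) Nat.one_pos (by omega) {u} u
  generalize lastSat (PointsAt G S {u} 1) u n = y at hy hy' h'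
  simp only [mem_outNbrs, mem_singleton, exists_eq_left] at hy
  refine ⟨u, y, ?_, hux, hy.2, hy.1, m₀ + B ^ r * 1, add_pow_mul_lt hm₀ (by omega),
    iterate_walkStep_succ (w := ⟨{u}, u, 0⟩) (w' := ⟨{y}, y, 0⟩) h h'⟩
  rcases hy' with ⟨hy', -⟩ | ⟨-, hy'⟩
  · exact hy'
  · omega

/-- If no vertex can be added greedily, some walk ends at an optimal next vertex. -/
theorem Completable.exists_code (hG : G.Connected) {S : Finset (Fin n)} (hS : S.Nonempty)
    (hS' : S ≠ univ) {b k : ℕ} (hbk : b ≤ k) (h : Completable G S b) (hno : ∀ v, ¬ ThinAt G S v)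
    (a : Fin n) : ∃ v ∉ S, ∃ b', Completable G (insert v S) b' ∧
      b' + (#(bdry G (insert v S)) - 1) ≤ b ∧ 2 ≤ #(bdry G (insert v S)) ∧
      ∃ m₀ < (2 * k + 6) ^ (k + 2), ∀ m, nextVertex G (2 * k + 6) (k + 2) a S
        (m₀ + (2 * k + 6) ^ (k + 2) * m) = (v, m) := by
  have hthin : ∀ v ∉ S, 2 ≤ #(bdry G (insert v S)) := fun v hv => by
    by_contra hlt
    exact hno v ⟨hv, by omega⟩
  have hB : ∀ u ∉ S, #(innerNbrs G S {u}) + 2 ≤ 2 * k + 6 := fun u hu => by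
    have := h.card_innerNbrs_singleton_le hu
    omega
  cases h with
  | full => exact absurd rfl hS'
  | @step _ x b' _ hx h hc =>
    have hB' : #(innerNbrs G S S) + 2 ≤ 2 * k + 6 := by
      have := card_innerNbrs_self_le (G := G) S x
      omega
    have hlayer : x ∈ layer G S (k + 2) := layer_mono S (by omega) (h.mem_layer hG hS hx)
    by_cases hp : Pendant G S x
    · obtain ⟨u, y, hy, hux, huy, hyS, m₀, hm₀, hwalk⟩ := exists_walk_pendant hB' hB a hlayer hp
      obtain ⟨h1, h2⟩ := h.insert_twin hp hy hux huy hx hyS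
      refine ⟨y, hyS, b', h1, by omega, hthin y hyS, m₀, hm₀, fun m => ?_⟩
      rw [nextVertex, if_neg (not_exists.2 hno), hwalk]
    · obtain ⟨m₀, hm₀, hwalk⟩ := exists_walk hB' hB a (k + 2) x hlayer hp
      refine ⟨x, hx, b', h, hc, hthin x hx, m₀, hm₀, fun m => ?_⟩
      rw [nextVertex, if_neg (not_exists.2 hno), hwalk]

theorem iterate_searchStep_univ (B r : ℕ) (a : Fin n) (i : ℕ) (s : Search n)
    (hs : s.done = univ) : ((searchStep G B r a)^[i] s).done = univ ∧
      ((searchStep G B r a)^[i] s).cost = s.cost := by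
  induction i with
  | zero => exact ⟨hs, rfl⟩
  | succ i ih =>
    rw [Function.iterate_succ_apply']
    generalize (searchStep G B r a)^[i] s = s' at ih
    simp only [searchStep, ih.1, insert_eq_of_mem (mem_univ _), bdry_univ, card_empty]
    exact ⟨trivial, ih.2⟩

/-- Each walk is charged to the excess of the set that its end vertex leads to, so that `b` walks
suffice. -/
theorem Completable.exists_search (hG : G.Connected) (k : ℕ) (a : Fin n) (i : ℕ) :
    ∀ (S : Finset (Fin n)) (b : ℕ), S.Nonempty → Completable G S b → b ≤ k → #Sᶜ ≤ i →
      ∃ m < (2 * k + 6) ^ ((k + 2) * b), ∀ c,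
        ((searchStep G (2 * k + 6) (k + 2) a)^[i] ⟨S, c, m⟩).done = univ ∧
        ((searchStep G (2 * k + 6) (k + 2) a)^[i] ⟨S, c, m⟩).cost ≤ c + b + (#Sᶜ - 1) := by
  have hfull : ∀ i b, ∃ m < (2 * k + 6) ^ ((k + 2) * b), ∀ c,
      ((searchStep G (2 * k + 6) (k + 2) a)^[i] ⟨univ, c, m⟩).done = univ ∧
      ((searchStep G (2 * k + 6) (k + 2) a)^[i] ⟨univ, c, m⟩).cost ≤
        c + b + (#(univ : Finset (Fin n))ᶜ - 1) := fun i b => by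
    refine ⟨0, by positivity, fun c => ?_⟩
    obtain ⟨h1, h2⟩ := iterate_searchStep_univ (G := G) (2 * k + 6) (k + 2) a i ⟨univ, c, 0⟩ rfl
    exact ⟨h1, by rw [h2]; simp only; omega⟩
  induction i with
  | zero =>
    intro S b _ _ _ hi
    have : S = univ := by simpa using hi
    subst this
    exact hfull 0 b
  | succ i ih =>
    intro S b hS h hbk hi
    by_cases hS' : S = univ
    · subst hS'; exact hfull _ b
    have hcard : ∀ v ∉ S, #(insert v S)ᶜ = #Sᶜ - 1 := fun v hv => by
      rw [card_compl, card_insert_of_notMem hv, card_compl]; omega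
    -- The boundary of the last set is empty, every other set costs its excess and one more.
    have hcost : ∀ v ∉ S, #(bdry G (insert v S)) + (#(insert v S)ᶜ - 1) ≤
        (#(bdry G (insert v S)) - 1) + (#Sᶜ - 1) := fun v hv => by
      have h1 := hcard v hv
      by_cases hu : insert v S = univ
      · simp [hu, bdry_univ]
      · have : 0 < #(insert v S)ᶜ := card_pos.2 (by
          rw [nonempty_iff_ne_empty, Ne, compl_eq_empty_iff]; exact hu)
        omega
    by_cases hthin : ∃ v, ThinAt G S v
    · obtain ⟨hv, hv'⟩ := lastSat_spec (P := ThinAt G S) (a := a) (j := n)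
        (hthin.imp fun v hv => ⟨hv, v.2⟩)
      have hstep : ∀ c m, searchStep G (2 * k + 6) (k + 2) a ⟨S, c, m⟩ =
          ⟨insert (lastSat (ThinAt G S) a n) S,
            c + #(bdry G (insert (lastSat (ThinAt G S) a n) S)), m⟩ := fun c m => by
        simp [searchStep, nextVertex, hthin]
      generalize lastSat (ThinAt G S) a n = v at hv hv' hstep
      obtain ⟨m, hm, hrun⟩ := ih (insert v S) b (insert_nonempty _ _)
        (h.insert_of_thin hG hS hv hv') hbk (by rw [hcard v hv]; omega)
      refine ⟨m, hm, fun c => ?_⟩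
      rw [Function.iterate_succ_apply, hstep]
      obtain ⟨h1, h2⟩ := hrun (c + #(bdry G (insert v S)))
      refine ⟨h1, h2.trans ?_⟩
      have := hcost v hv
      omega
    · obtain ⟨v, hv, b', h', hb', h2, m₀, hm₀, hnext⟩ :=
        h.exists_code hG hS hS' hbk (not_exists.1 hthin) a
      obtain ⟨m, hm, hrun⟩ := ih (insert v S) b' (insert_nonempty _ _) h' (by omega)
        (by rw [hcard v hv]; omega)
      refine ⟨m₀ + (2 * k + 6) ^ (k + 2) * m, ?_, fun c => ?_⟩
      · calc m₀ + (2 * k + 6) ^ (k + 2) * m < (2 * k + 6) ^ (k + 2) * (m + 1) := by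
              rw [mul_add, mul_one]; omega
          _ ≤ (2 * k + 6) ^ (k + 2) * (2 * k + 6) ^ ((k + 2) * b') := Nat.mul_le_mul_left _ hm
          _ = (2 * k + 6) ^ ((k + 2) * (b' + 1)) := by ring
          _ ≤ (2 * k + 6) ^ ((k + 2) * b) :=
              Nat.pow_le_pow_right (by omega) (Nat.mul_le_mul_left _ (by omega))
      · have hstep : searchStep G (2 * k + 6) (k + 2) a
            ⟨S, c, m₀ + (2 * k + 6) ^ (k + 2) * m⟩ =
            ⟨insert v S, c + #(bdry G (insert v S)), m⟩ := by
          simp [searchStep, hnext]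
        rw [Function.iterate_succ_apply, hstep]
        obtain ⟨h3, h4⟩ := hrun (c + #(bdry G (insert v S)))
        refine ⟨h3, h4.trans ?_⟩
        have := hcost v hv
        omega

/-- The number of codes that the search tries, a bound for `(2k + 6) ^ ((k + 2) * k)`. -/
def codeBound (k : ℕ) : ℕ := 2 ^ 2 ^ (4 * k + 8)

theorem pow_le_codeBound (k : ℕ) : (2 * k + 6) ^ ((k + 2) * k) ≤ codeBound k := by
  have h : ∀ x : ℕ, x ≤ 2 ^ x := fun x => Nat.lt_two_pow_self.le
  calc (2 * k + 6) ^ ((k + 2) * k) ≤ (2 ^ (2 * k + 6)) ^ ((k + 2) * k) :=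
        Nat.pow_le_pow_left (h _) _
    _ = 2 ^ ((2 * k + 6) * ((k + 2) * k)) := (pow_mul _ _ _).symm
    _ ≤ 2 ^ (2 ^ (2 * k + 6) * (2 ^ (k + 2) * 2 ^ k)) :=
        Nat.pow_le_pow_right (by omega)
          (Nat.mul_le_mul (h _) (Nat.mul_le_mul (h _) (h _)))
    _ = codeBound k := by rw [codeBound, ← pow_add, ← pow_add]; ring_nf

/-- Some run of the search succeeds if and only if there is an ordering of small profile. -/
theorem exists_search_iff (hG : G.Connected) (k : ℕ) :
    (∃ (a : Fin n), ∃ m < codeBound k,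
      ((searchStep G (2 * k + 6) (k + 2) a)^[n] (searchInit G a m)).done = univ ∧
      ((searchStep G (2 * k + 6) (k + 2) a)^[n] (searchInit G a m)).cost ≤ n - 1 + k) ↔
    ∃ α : VertexOrdering (Fin n), orderingProfile G α ≤ n - 1 + k := by
  constructor
  · rintro ⟨a, m, -, h1, h2⟩
    exact search_sound _ _ a m n h1 h2
  · rintro ⟨α, hα⟩
    have h := completable_of_orderingProfile_le hG α (k := k) (by simpa using hα)
    have hne := hG.nonempty
    generalize hS : (∅ : Finset (Fin n)) = S at h
    cases h with
    | full => exact absurd hS univ_nonempty.ne_empty.symm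
    | @step _ a b _ ha h hc =>
      subst hS
      have hcompl : #({a} : Finset (Fin n))ᶜ = n - 1 := by simp [card_compl]
      obtain ⟨m, hm, hrun⟩ := Completable.exists_search hG k a n {a} b (singleton_nonempty a) h
        (by omega) (by omega)
      obtain ⟨h1, h2⟩ := hrun #(bdry G {a})
      refine ⟨a, m, ?_, h1, h2.trans ?_⟩
      · exact hm.trans_le ((Nat.pow_le_pow_right (by omega)
          (Nat.mul_le_mul_left _ (by omega))).trans (pow_le_codeBound k))
      · rw [insert_empty_eq] at hc
        by_cases hu : ({a} : Finset (Fin n)) = univ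
        · rw [hu, bdry_univ]
          simp
          omega
        · have : 0 < #({a} : Finset (Fin n))ᶜ := card_pos.2 (by
            rw [nonempty_iff_ne_empty, Ne, compl_eq_empty_iff]; exact hu)
          omega

end Search

/-! ### Correctness and running time of programs -/

open RAM

/-- `Exec p s T Q`: started in state `s`, the program `p` halts after at most `T` steps in a state
that satisfies `Q`. -/
def Exec (p : Program) (s : State) (T : ℕ) (Q : State → Prop) : Prop :=
  ∃ t s', Runs p s t s' ∧ t ≤ T ∧ Q s'

/-- Whether the program contains an assignment to the register `x`. -/
def modReg : Program → ℕ → Bool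
  | .skip, _ => false
  | .set y _, x => x == y
  | .put _ _ _, _ => false
  | .seq p q, x => modReg p x || modReg q x
  | .ite _ p q, x => modReg p x || modReg q x
  | .loop _ p, x => modReg p x

/-- Whether the program contains an assignment to the array `a`. -/
def modArr : Program → ℕ → Bool
  | .skip, _ => false
  | .set _ _, _ => false
  | .put b _ _, a => a == b
  | .seq p q, a => modArr p a || modArr q a
  | .ite _ p q, a => modArr p a || modArr q a
  | .loop _ p, a => modArr p a

/-- The states `s` and `s'` agree on everything that `p` does not assign to. -/
structure Frame (p : Program) (s s' : State) : Prop where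
  reg : ∀ x, modReg p x = false → s'.reg x = s.reg x
  arr : ∀ a, modArr p a = false → s'.arr a = s.arr a

@[simp] theorem reg_setReg (s : State) (x v y : ℕ) :
    (s.setReg x v).reg y = if y = x then v else s.reg y := by
  simp [State.setReg, Function.update_apply]

@[simp] theorem arr_setReg (s : State) (x v : ℕ) : (s.setReg x v).arr = s.arr := rfl

@[simp] theorem reg_setArr (s : State) (a i v : ℕ) : (s.setArr a i v).reg = s.reg := rfl

@[simp] theorem arr_setArr (s : State) (a i v b j : ℕ) :
    (s.setArr a i v).arr b j = if b = a ∧ j = i then v else s.arr b j := by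
  by_cases hb : b = a
  · subst hb
    simp [State.setArr, Function.update_apply]
  · simp [State.setArr, hb]

theorem frame_of_runs {p : Program} {s s' : State} {t : ℕ} (h : Runs p s t s') :
    Frame p s s' := by
  induction h with
  | skip s => exact ⟨fun _ _ => rfl, fun _ _ => rfl⟩
  | set x e s =>
    refine ⟨fun y hy => ?_, fun _ _ => rfl⟩
    simp only [modReg, beq_eq_false_iff_ne] at hy
    simp [hy]
  | put a i e s =>
    refine ⟨fun _ _ => rfl, fun b hb => ?_⟩
    simp only [modArr, beq_eq_false_iff_ne] at hb
    funext j
    simp [hb]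
  | seq _ _ ih₁ ih₂ =>
    refine ⟨fun x hx => ?_, fun x hx => ?_⟩
    · simp only [modReg, Bool.or_eq_false_iff] at hx
      rw [ih₂.reg x hx.2, ih₁.reg x hx.1]
    · simp only [modArr, Bool.or_eq_false_iff] at hx
      rw [ih₂.arr x hx.2, ih₁.arr x hx.1]
  | ite_true _ _ ih =>
    refine ⟨fun x hx => ?_, fun x hx => ?_⟩
    · simp only [modReg, Bool.or_eq_false_iff] at hx
      exact ih.reg x hx.1
    · simp only [modArr, Bool.or_eq_false_iff] at hx
      exact ih.arr x hx.1
  | ite_false _ _ ih =>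
    refine ⟨fun x hx => ?_, fun x hx => ?_⟩
    · simp only [modReg, Bool.or_eq_false_iff] at hx
      exact ih.reg x hx.2
    · simp only [modArr, Bool.or_eq_false_iff] at hx
      exact ih.arr x hx.2
  | loop_done _ => exact ⟨fun _ _ => rfl, fun _ _ => rfl⟩
  | loop_step _ _ _ ih₁ ih₂ =>
    exact ⟨fun x hx => (ih₂.reg x hx).trans (ih₁.reg x hx),
      fun x hx => (ih₂.arr x hx).trans (ih₁.arr x hx)⟩

section Rules

variable {p q : Program} {e : Expr} {s : State} {T T₁ T₂ : ℕ} {Q R : State → Prop}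

theorem Exec.mono (h : Exec p s T₁ Q) (hT : T₁ ≤ T₂) : Exec p s T₂ Q := by
  obtain ⟨t, s', h1, h2, h3⟩ := h
  exact ⟨t, s', h1, h2.trans hT, h3⟩

/-- The rule of consequence, combined with the frame property. -/
theorem Exec.imp (h : Exec p s T Q) (hQ : ∀ s', Frame p s s' → Q s' → R s') :
    Exec p s T R := by
  obtain ⟨t, s', h1, h2, h3⟩ := h
  exact ⟨t, s', h1, h2, hQ s' (frame_of_runs h1) h3⟩

theorem Exec.skip (h : Q s) : Exec .skip s 1 Q := ⟨1, s, .skip s, le_rfl, h⟩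

theorem Exec.set {x : ℕ} (h : Q (s.setReg x (e.eval s))) : Exec (.set x e) s (e.cost + 1) Q :=
  ⟨_, _, .set x e s, le_rfl, h⟩

theorem Exec.put {a : ℕ} {i : Expr} (h : Q (s.setArr a (i.eval s) (e.eval s))) :
    Exec (.put a i e) s (i.cost + e.cost + 1) Q :=
  ⟨_, _, .put a i e s, le_rfl, h⟩

theorem Exec.seq (h : Exec p s T₁ fun s' => Exec q s' T₂ Q) : Exec (.seq p q) s (T₁ + T₂) Q := by
  obtain ⟨t₁, s₁, h1, h2, t₂, s₂, h3, h4, h5⟩ := h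
  exact ⟨_, _, .seq h1 h3, by omega, h5⟩

theorem Exec.ite (h₁ : e.eval s ≠ 0 → Exec p s T₁ Q) (h₂ : e.eval s = 0 → Exec q s T₂ Q) :
    Exec (.ite e p q) s (e.cost + 1 + T₁ + T₂) Q := by
  by_cases h : e.eval s = 0
  · obtain ⟨t, s', h1, h2, h3⟩ := h₂ h
    exact ⟨_, _, .ite_false h h1, by omega, h3⟩
  · obtain ⟨t, s', h1, h2, h3⟩ := h₁ h
    exact ⟨_, _, .ite_true h h1, by omega, h3⟩

/-- Loops with an invariant `I` and a variant `μ`. -/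
theorem Exec.loop (I : State → Prop) (μ : State → ℕ) (h0 : I s)
    (hstep : ∀ s', Frame p s s' → I s' → e.eval s' ≠ 0 → Exec p s' T fun s'' =>
      I s'' ∧ μ s'' < μ s') :
    Exec (.loop e p) s ((μ s + 1) * (T + e.cost + 1)) fun s' => I s' ∧ e.eval s' = 0 := by
  suffices H : ∀ N s', Frame p s s' → I s' → μ s' ≤ N →
      Exec (.loop e p) s' ((N + 1) * (T + e.cost + 1)) fun s'' => I s'' ∧ e.eval s'' = 0 from
    H (μ s) s ⟨fun _ _ => rfl, fun _ _ => rfl⟩ h0 le_rfl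
  intro N
  induction N with
  | zero =>
    intro s' hf hI hμ
    by_cases h : e.eval s' = 0
    · exact ⟨_, _, .loop_done h, by omega, hI, h⟩
    · obtain ⟨t, s'', -, -, -, h4⟩ := hstep s' hf hI h
      omega
  | succ N ih =>
    intro s' hf hI hμ
    by_cases h : e.eval s' = 0
    · exact ⟨_, _, .loop_done h, by nlinarith, hI, h⟩
    · obtain ⟨t, s'', h1, h2, h3, h4⟩ := hstep s' hf hI h
      have hf' := frame_of_runs h1
      obtain ⟨t', s₃, h5, h6, h7⟩ := ih s''
        ⟨fun x hx => (hf'.reg x hx).trans (hf.reg x hx),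
          fun x hx => (hf'.arr x hx).trans (hf.arr x hx)⟩ h3 (by omega)
      exact ⟨_, _, .loop_step h h1 h5, by nlinarith, h7⟩

/-- `for i := 0, …, b - 1 do p`, where `b` is a register. -/
def forUp (i b : ℕ) (p : Program) : Program :=
  .seq (.set i (.const 0))
    (.loop (.sub (.var b) (.var i)) (.seq p (.set i (.add (.var i) (.const 1)))))

/-- The invariant `I j` holds before the round with number `j`. -/
theorem Exec.forUp {i b N : ℕ} (I : ℕ → State → Prop) (hb : s.reg b = N) (hib : b ≠ i)
    (hpb : modReg p b = false) (hpi : modReg p i = false) (h0 : I 0 (s.setReg i 0))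
    (hstep : ∀ j s', j < N → s'.reg i = j → (∀ x, modReg p x = false → x ≠ i →
      s'.reg x = s.reg x) → (∀ a, modArr p a = false → s'.arr a = s.arr a) → I j s' →
      Exec p s' T fun s'' => I (j + 1) (s''.setReg i (j + 1))) :
    Exec (forUp i b p) s ((N + 1) * (T + 10)) (I N) := by
  have h := Exec.loop (p := .seq p (.set i (.add (.var i) (.const 1))))
    (e := .sub (.var b) (.var i)) (s := s.setReg i 0) (T := T + 4)
    (fun s' => s'.reg b = N ∧ s'.reg i ≤ N ∧ I (s'.reg i) s') (fun s' => N - s'.reg i)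
    ⟨by simp [hib, hb], by simp, by simpa using h0⟩ (by
      rintro s' hf ⟨h1, h2, h3⟩ h4
      simp only [Expr.eval, h1] at h4
      refine Exec.seq ((hstep (s'.reg i) s' (by omega) rfl (fun x hx hxi => ?_) (fun a ha => ?_)
        h3).imp fun s'' hf' hI => ?_)
      · rw [hf.reg x (by simp [modReg, hx, hxi])]
        simp [hxi]
      · rw [hf.arr a (by simp [modArr, ha])]
        rfl
      · refine Exec.set ?_
        simp only [Expr.eval, hf'.reg i hpi]
        refine ⟨⟨?_, ?_, ?_⟩, ?_⟩
        · rw [reg_setReg, if_neg hib, hf'.reg b hpb, h1]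
        · simp only [reg_setReg, if_true]; omega
        · simpa using hI
        · simp only [reg_setReg, if_true]; omega)
  refine (Exec.seq (Exec.set (h.imp ?_))).mono ?_
  · rintro s' - ⟨⟨h1, h2, h3⟩, h4⟩
    simp only [Expr.eval, h1] at h4
    have : s'.reg i = N := by omega
    rwa [this] at h3
  · simp only [Expr.cost, reg_setReg, if_true, Nat.sub_zero]
    nlinarith

end Rules

/-! ### Subroutines -/

-- The arrays: the adjacency matrix, the starting positions of its rows, the set of the vertices
-- ordered so far, and an auxiliary set (the source of a walk, the set reached from a vertex).
local notation "adjA" => 0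
local notation "rowA" => 1
local notation "setA" => 2
local notation "srcA" => 3
-- The registers. The first two hold the input, `outR` also the final answer; nested
-- loops have different counters.
local notation "outR" => 0
local notation "kR" => 1
local notation "nR" => 2
local notation "resR" => 3
local notation "baseR" => 4
local notation "lenR" => 5
local notation "boundR" => 6
local notation "startR" => 7
local notation "roundR" => 8
local notation "codeR" => 9
local notation "costR" => 10
local notation "stepR" => 11
local notation "foundR" => 12
local notation "vR" => 13
local notation "cR" => 14
local notation "xR" => 15
local notation "yR" => 16
local notation "flR" => 17
local notation "zR" => 18
local notation "wR" => 19
local notation "dR" => 20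
local notation "qR" => 21
local notation "cntR" => 22
local notation "pR" => 23
local notation "degR" => 24
local notation "uR" => 25
local notation "iR" => 26
local notation "okR" => 27
local notation "sqR" => 28
local notation "expR" => 29

section Subroutines

variable {n : ℕ} {G : SimpleGraph (Fin n)}

open Classical in
/-- The memory holds `n` and the adjacency matrix of `G`; the array `rowA` holds the starting
positions of the rows. -/
structure HasGraph (G : SimpleGraph (Fin n)) (s : State) : Prop where
  reg_n : s.reg nR = n
  adj : ∀ i j : Fin n, s.arr adjA (s.arr rowA i + j) = if G.Adj i j then 1 else 0

theorem HasGraph.congr {s s' : State} (h : HasGraph G s) (h1 : s'.reg nR = s.reg nR)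
    (h2 : s'.arr adjA = s.arr adjA) (h3 : s'.arr rowA = s.arr rowA) : HasGraph G s' :=
  ⟨h1.trans h.reg_n, by rw [h2, h3]; exact h.adj⟩

/-- The first `n` entries of an array are the characteristic function of `S`. -/
def IsIndicator (f : ℕ → ℕ) (S : Finset (Fin n)) : Prop :=
  ∀ v : Fin n, f v = if v ∈ S then 1 else 0

/-- Whether the vertices in the registers `x` and `y` are adjacent. -/
def adjE (x y : ℕ) : Expr := .get adjA (.add (.get rowA (.var x)) (.var y))

theorem cost_adjE (x y : ℕ) : (adjE x y).cost = 5 := rfl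

open Classical in
theorem HasGraph.eval_adjE {s : State} (h : HasGraph G s) {x y : ℕ} {i j : Fin n}
    (hx : s.reg x = i) (hy : s.reg y = j) :
    (adjE x y).eval s = if G.Adj i j then 1 else 0 := by
  simp only [adjE, Expr.eval, hx, hy, h.adj]

/-- Sets the register `flR` to `1` if the vertex in the register `x` has a neighbour in the set
stored in the array `C`, and to `0` otherwise. -/
def flagP (C x : ℕ) : Program :=
  .seq (.set flR (.const 0))
    (forUp yR nR (.ite (.get C (.var yR)) (.ite (adjE yR x) (.set flR (.const 1)) .skip) .skip))

open Classical in
theorem exec_flagP {s : State} (hG : HasGraph G s) {C x : ℕ} {S : Finset (Fin n)}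
    (hC : IsIndicator (s.arr C) S) {v : Fin n} (hx : s.reg x = v) (hxf : x ≠ flR) (hxy : x ≠ yR) :
    Exec (flagP C x) s (40 * (n + 1)) fun s' =>
      s'.reg flR = if ∃ y ∈ S, G.Adj y v then 1 else 0 := by
  refine (Exec.seq (Exec.set (Exec.forUp (N := n) (T := 20) (fun j s' => s'.reg flR =
    if ∃ y ∈ S, y.1 < j ∧ G.Adj y v then 1 else 0) ?_ (by decide) rfl rfl ?_ ?_))).mono ?_ |>.imp ?_
  · simp [hG.reg_n]
  · simp [Expr.eval]
  · intro j s' hj hjs hr ha hI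
    have hG' : HasGraph G s' := hG.congr (hr nR rfl (by decide)) (ha adjA rfl) (ha rowA rfl)
    have hxs : s'.reg x = v := by
      rw [hr x (by simp [modReg, hxf]) hxy]
      simp [hxf, hx]
    have hCj : (Expr.get C (.var yR)).eval s' = if (⟨j, hj⟩ : Fin n) ∈ S then 1 else 0 := by
      simp only [Expr.eval, hjs]
      rw [ha C rfl]
      exact hC ⟨j, hj⟩
    have hadj := hG'.eval_adjE (x := yR) (y := x) (i := ⟨j, hj⟩) hjs hxs
    have hiff : (∃ y ∈ S, y.1 < j + 1 ∧ G.Adj y v) ↔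
        ((⟨j, hj⟩ : Fin n) ∈ S ∧ G.Adj ⟨j, hj⟩ v) ∨ ∃ y ∈ S, y.1 < j ∧ G.Adj y v := by
      constructor
      · rintro ⟨y, hy, hyj, hyv⟩
        rcases Nat.lt_succ_iff_lt_or_eq.1 hyj with h | h
        · exact Or.inr ⟨y, hy, h, hyv⟩
        · obtain rfl : y = ⟨j, hj⟩ := Fin.ext h
          exact Or.inl ⟨hy, hyv⟩
      · rintro (⟨h1, h2⟩ | ⟨y, h1, h2, h3⟩)
        · exact ⟨_, h1, Nat.lt_succ_self j, h2⟩
        · exact ⟨y, h1, by omega, h3⟩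
    simp only [hiff]
    refine (Exec.ite (fun h1 => Exec.ite (fun h2 => Exec.set ?_) (fun h2 => Exec.skip ?_))
      (fun h1 => Exec.skip ?_)).mono (by simp [Expr.cost, cost_adjE])
    · rw [hCj] at h1
      rw [hadj] at h2
      simp only [ne_eq, ite_eq_right_iff, one_ne_zero, imp_false, not_not] at h1 h2
      simp [Expr.eval, h1, h2]
    · rw [hadj] at h2
      simp only [ite_eq_right_iff, one_ne_zero, imp_false] at h2
      simp [hI, h2]
    · rw [hCj] at h1
      simp only [ite_eq_right_iff, one_ne_zero, imp_false] at h1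
      simp [hI, h1]
  · simp only [Expr.cost]; omega
  · intro s' _ h
    rw [h]
    simp

/-- Sets the register `cR` to the size of the boundary of the set stored in `setA`. -/
def countP : Program :=
  .seq (.set cR (.const 0)) (forUp xR nR (.ite (.get setA (.var xR)) .skip
    (.seq (flagP setA xR) (.set cR (.add (.var cR) (.var flR))))))

theorem card_filter_lt_succ (Q : Finset (Fin n)) {j : ℕ} (hj : j < n) :
    #{x ∈ Q | x.1 < j + 1} = #{x ∈ Q | x.1 < j} + if (⟨j, hj⟩ : Fin n) ∈ Q then 1 else 0 := by
  have h : {x ∈ Q | x.1 < j + 1} =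
      {x ∈ Q | x.1 < j} ∪ if (⟨j, hj⟩ : Fin n) ∈ Q then {⟨j, hj⟩} else ∅ := by
    ext x
    have hx : x = ⟨j, hj⟩ ↔ x.1 = j := Fin.ext_iff
    by_cases hxj : x = ⟨j, hj⟩
    · subst hxj
      by_cases h : (⟨j, hj⟩ : Fin n) ∈ Q <;> simp [h]
    · have : x.1 ≠ j := fun h => hxj (hx.2 h)
      split_ifs <;> simp [hxj] <;> intro _ <;> omega
  rw [h, card_union_of_disjoint]
  · split_ifs <;> simp
  · split_ifs
    · simp
    · simp

theorem sum_filter_lt_succ (f : Fin n → ℕ) {j : ℕ} (hj : j < n) :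
    ∑ x with x.1 < j + 1, f x = ∑ x with x.1 < j, f x + f ⟨j, hj⟩ := by
  have h : (univ.filter fun x : Fin n => x.1 < j + 1) =
      insert ⟨j, hj⟩ (univ.filter fun x : Fin n => x.1 < j) := by
    ext x
    simp only [mem_filter, mem_univ, true_and, mem_insert, Fin.ext_iff]
    omega
  rw [h, sum_insert (by simp), add_comm]

theorem exec_countP {s : State} (hG : HasGraph G s) {S : Finset (Fin n)}
    (hS : IsIndicator (s.arr setA) S) :
    Exec countP s (120 * (n + 1) ^ 2) fun s' => s'.reg cR = #(bdry G S) := by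
  classical
  refine (Exec.seq (Exec.set (Exec.forUp (N := n) (T := 40 * (n + 1) + 20) (fun j s' =>
    s'.reg cR = #{x ∈ bdry G S | x.1 < j}) ?_ (by decide) rfl rfl ?_ ?_))).mono ?_ |>.imp ?_
  · simp [hG.reg_n]
  · simp [Expr.eval]
  · intro j s' hj hjs hr ha hI
    have hG' : HasGraph G s' := hG.congr (hr nR rfl (by decide)) (ha adjA rfl) (ha rowA rfl)
    have hS' : IsIndicator (s'.arr setA) S := by rw [ha setA rfl]; exact hS
    have hSj : (Expr.get setA (.var xR)).eval s' = if (⟨j, hj⟩ : Fin n) ∈ S then 1 else 0 := by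
      simp only [Expr.eval, hjs]
      exact hS' ⟨j, hj⟩
    rw [card_filter_lt_succ _ hj]
    refine (Exec.ite (fun h1 => Exec.skip ?_) (fun h1 => Exec.seq ((exec_flagP hG' hS'
      (v := ⟨j, hj⟩) hjs (by decide) (by decide)).imp fun s'' hf h2 => Exec.set ?_))).mono
        (by simp only [Expr.cost]; omega)
    · rw [hSj] at h1
      simp only [ne_eq, ite_eq_right_iff, one_ne_zero, imp_false, not_not] at h1
      simp [hI, mem_outNbrs, h1]
    · rw [hSj] at h1
      simp only [ite_eq_right_iff, one_ne_zero, imp_false] at h1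
      simp [Expr.eval, h2, hf.reg cR rfl, hI, mem_outNbrs, h1]
  · simp only [Expr.cost]; nlinarith
  · intro s' _ h
    rw [h]
    simp

/-- Each vertex outside the set is added to it, the boundary is counted, and the vertex is removed
again. Sets the register `foundR` to `1` and the register `vR` to the last vertex whose addition to
the set stored in `setA` leaves a boundary of size at most one; if there is none, `foundR` is set to
`0` and `vR` to the start vertex. -/
def thinP : Program :=
  .seq (.set foundR (.const 0)) (.seq (.set vR (.var startR))
    (forUp zR nR (.ite (.get setA (.var zR)) .skip
      (.seq (.put setA (.var zR) (.const 1)) (.seq countP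
        (.seq (.put setA (.var zR) (.const 0))
          (.ite (.sub (.var cR) (.const 1)) .skip
            (.seq (.set vR (.var zR)) (.set foundR (.const 1))))))))))

theorem IsIndicator.insert {f g : ℕ → ℕ} {S : Finset (Fin n)} (hf : IsIndicator f S) {v : Fin n}
    (hg : ∀ i, g i = if i = v then 1 else f i) : IsIndicator g (insert v S) := by
  intro x
  rw [hg, hf]
  by_cases h : x = v
  · simp [h]
  · have : x.1 ≠ v.1 := fun h' => h (Fin.ext h')
    simp [h, this]

theorem lastSat_eq_of_forall_not {P : Fin n → Prop} {a : Fin n} {j : ℕ} (h : ∀ x, ¬ P x) :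
    lastSat P a j = a := by
  induction j with
  | zero => rfl
  | succ j ih => rw [lastSat, dif_neg fun h' => h _ h'.2, ih]

open Classical in
theorem lastSat_succ {P : Fin n → Prop} {a : Fin n} {j : ℕ} (hj : j < n) :
    lastSat P a (j + 1) = if P ⟨j, hj⟩ then ⟨j, hj⟩ else lastSat P a j := by
  rw [lastSat]
  by_cases h : P ⟨j, hj⟩
  · rw [dif_pos ⟨hj, h⟩, if_pos h]
  · rw [dif_neg fun h' => h h'.2, if_neg h]

open Classical in
theorem exec_thinP {s : State} (hG : HasGraph G s) {S : Finset (Fin n)}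
    (hS : IsIndicator (s.arr setA) S) {a : Fin n} (ha : s.reg startR = a) :
    Exec thinP s (200 * (n + 1) ^ 3) fun s' => IsIndicator (s'.arr setA) S ∧
      s'.reg vR = lastSat (ThinAt G S) a n ∧
      s'.reg foundR = if ∃ v, ThinAt G S v then 1 else 0 := by
  refine (Exec.seq (Exec.set (Exec.seq (Exec.set (Exec.forUp (N := n)
    (T := 120 * (n + 1) ^ 2 + 40) (fun j s' => IsIndicator (s'.arr setA) S ∧
      s'.reg vR = lastSat (ThinAt G S) a j ∧
      s'.reg foundR = if ∃ v, ThinAt G S v ∧ v.1 < j then 1 else 0)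
        ?_ (by decide) rfl rfl ?_ ?_))))).mono ?_ |>.imp ?_
  · simp [hG.reg_n]
  · simp [Expr.eval, hS, ha, lastSat]
  · rintro j s' hj hjs hr ha ⟨hI1, hI2, hI3⟩
    have hG' : HasGraph G s' := hG.congr (hr nR rfl (by decide)) (ha adjA rfl) (ha rowA rfl)
    have hSj : (Expr.get setA (.var zR)).eval s' = if (⟨j, hj⟩ : Fin n) ∈ S then 1 else 0 := by
      simp only [Expr.eval, hjs]
      exact hI1 ⟨j, hj⟩
    have hiff : (∃ v, ThinAt G S v ∧ v.1 < j + 1) ↔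
        ThinAt G S ⟨j, hj⟩ ∨ ∃ v, ThinAt G S v ∧ v.1 < j := by
      constructor
      · rintro ⟨y, hy, hyj⟩
        rcases Nat.lt_succ_iff_lt_or_eq.1 hyj with h | h
        · exact Or.inr ⟨y, hy, h⟩
        · obtain rfl : y = ⟨j, hj⟩ := Fin.ext h
          exact Or.inl hy
      · rintro (h1 | ⟨y, h1, h2⟩)
        · exact ⟨_, h1, Nat.lt_succ_self j⟩
        · exact ⟨y, h1, by omega⟩
    simp only [hiff, lastSat_succ hj]
    refine (Exec.ite (fun h1 => Exec.skip ?_) (fun h1 => Exec.seq (Exec.put (Exec.seq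
      ((exec_countP (G := G) (S := insert ⟨j, hj⟩ S) ?_ ?_).imp fun s'' hf h2 => Exec.seq (Exec.put
        (Exec.ite (fun h3 => Exec.skip ?_) (fun h3 => Exec.seq (Exec.set (Exec.set ?_)))))))))).mono
        (by simp only [Expr.cost]; omega)
    · rw [hSj] at h1
      simp only [ne_eq, ite_eq_right_iff, one_ne_zero, imp_false, not_not] at h1
      have hn : ¬ ThinAt G S ⟨j, hj⟩ := fun h => h.1 h1
      simp [hI1, hI2, hI3, hn]
    · exact hG'.congr rfl (by funext i; simp) (by funext i; simp)
    · exact hI1.insert fun i => by simp [Expr.eval, hjs]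
    all_goals
      rw [hSj] at h1
      simp only [ite_eq_right_iff, one_ne_zero, imp_false] at h1
      have hz : s''.reg zR = j := by rw [hf.reg zR rfl]; exact hjs
      have hset : ∀ i, (s''.setArr setA j 0).arr setA i = s'.arr setA i := by
        intro i
        have := hI1 ⟨j, hj⟩
        rw [arr_setArr, hf.arr setA rfl]
        by_cases hi : i = j
        · simp [hi, this, h1]
        · simp [hi, Expr.eval, hjs]
      have hset' : IsIndicator ((s''.setArr setA j 0).arr setA) S :=
        fun v => (hset v).trans (hI1 v)
      have hthin : ThinAt G S ⟨j, hj⟩ ↔ #(bdry G (insert ⟨j, hj⟩ S)) ≤ 1 := by simp [ThinAt, h1]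
      simp [Expr.eval, h2] at h3
    · have hn : ¬ ThinAt G S ⟨j, hj⟩ := by rw [hthin]; omega
      refine ⟨?_, ?_, ?_⟩
      · simp only [Expr.eval, hz, arr_setReg]; exact hset'
      · simp [hf.reg vR rfl, hI2, hn]
      · simp [hf.reg foundR rfl, hI3, hn]
    · have hn : ThinAt G S ⟨j, hj⟩ := by rw [hthin]; omega
      refine ⟨?_, ?_, ?_⟩
      · simp only [Expr.eval, hz, arr_setReg]; exact hset'
      · simp [Expr.eval, hz, hn]
      · simp [Expr.eval, hn]
  · simp only [Expr.cost]; nlinarith [sq_nonneg n]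
  · rintro s' _ ⟨h1, h2, h3⟩
    refine ⟨h1, h2, ?_⟩
    rw [h3]
    simp

end Subroutines

/-! ### One step of the search -/

section Step

variable {n : ℕ} {G : SimpleGraph (Fin n)}

/-- Sets the register `degR` to the weighted degree of the vertex in the register `pR` with respect
to the set stored in `setA`. -/
def degreeP : Program :=
  .seq (.set degR (.const 0)) (forUp uR nR (.ite (adjE pR uR)
    (.set degR (.add (.var degR) (.add (.get setA (.var uR)) (.const 1)))) .skip))

open Classical in
theorem exec_degreeP {s : State} (hG : HasGraph G s) {S : Finset (Fin n)}
    (hS : IsIndicator (s.arr setA) S) {x : Fin n} (hx : s.reg pR = x) :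
    Exec degreeP s (40 * (n + 1)) fun s' => s'.reg degR = weightedDegree G S x := by
  refine (Exec.seq (Exec.set (Exec.forUp (N := n) (T := 20) (fun j s' => s'.reg degR =
    ∑ y with y.1 < j, if G.Adj x y then (if y ∈ S then 1 else 0) + 1 else 0)
      ?_ (by decide) rfl rfl ?_ ?_))).mono ?_ |>.imp ?_
  · simp [hG.reg_n]
  · simp [Expr.eval]
  · intro j s' hj hjs hr ha hI
    have hG' : HasGraph G s' := hG.congr (hr nR rfl (by decide)) (ha adjA rfl) (ha rowA rfl)
    have hxs : s'.reg pR = x := by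
      rw [hr pR rfl (by decide)]
      simp [hx]
    have hSj : s'.arr setA j = if (⟨j, hj⟩ : Fin n) ∈ S then 1 else 0 := by
      rw [ha setA rfl]
      exact hS ⟨j, hj⟩
    have hadj := hG'.eval_adjE (x := pR) (y := uR) (j := ⟨j, hj⟩) hxs hjs
    rw [sum_filter_lt_succ _ hj]
    refine (Exec.ite (fun h1 => Exec.set ?_) (fun h1 => Exec.skip ?_)).mono
      (by simp [Expr.cost, cost_adjE])
    · rw [hadj] at h1
      simp only [ne_eq, ite_eq_right_iff, one_ne_zero, imp_false, not_not] at h1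
      simp only [Expr.eval, hjs, hSj, hI, h1, reg_setReg]
      simp
    · rw [hadj] at h1
      simp only [ite_eq_right_iff, one_ne_zero, imp_false] at h1
      simp [hI, h1]
  · simp only [Expr.cost]; omega
  · intro s' _ h
    rw [h, weightedDegree]
    simp

/-- Sets the register `vR` to the last vertex outside the set stored in `setA` with a neighbour in
the set stored in `srcA` that the positive digit in the register `dR` points at, if there is one. -/
def pickP : Program :=
  .seq (.set cntR (.const 2)) (forUp pR nR (.ite (.get setA (.var pR)) .skip
    (.seq (flagP srcA pR) (.ite (.var flR)
      (.seq degreeP (.ite (.sub (.var degR) (.const 1))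
        (.seq (.ite (.add (.sub (.var dR) (.var cntR)) (.sub (.var cntR) (.var dR))) .skip
            (.set vR (.var pR)))
          (.set cntR (.add (.var cntR) (.const 1))))
        (.ite (.sub (.var dR) (.const 1)) .skip (.set vR (.var pR)))))
      .skip))))

open Classical in
theorem exec_pickP {s : State} (hG : HasGraph G s) {S C : Finset (Fin n)}
    (hS : IsIndicator (s.arr setA) S) (hC : IsIndicator (s.arr srcA) C) {d : ℕ} (hd : 0 < d)
    (hds : s.reg dR = d) {c : Fin n} (hc : s.reg vR = c) :
    Exec pickP s (200 * (n + 1) ^ 2) fun s' =>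
      s'.reg vR = lastSat (PointsAt G S C d) c n := by
  refine (Exec.seq (Exec.set (Exec.forUp (N := n) (T := 80 * (n + 1) + 60) (fun j s' =>
    s'.reg cntR = 2 + #{y ∈ innerNbrs G S C | y.1 < j} ∧
    s'.reg vR = lastSat (PointsAt G S C d) c j) ?_ (by decide) rfl rfl ?_ ?_))).mono ?_ |>.imp ?_
  · simp [hG.reg_n]
  · simp [Expr.eval, hc, lastSat]
  · rintro j s' hj hjs hr ha ⟨hI1, hI2⟩
    have hG' : HasGraph G s' := hG.congr (hr nR rfl (by decide)) (ha adjA rfl) (ha rowA rfl)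
    have hS' : IsIndicator (s'.arr setA) S := by rw [ha setA rfl]; exact hS
    have hC' : IsIndicator (s'.arr srcA) C := by rw [ha srcA rfl]; exact hC
    have hds' : s'.reg dR = d := by rw [hr dR rfl (by decide)]; simp [hds]
    have hSj : (Expr.get setA (.var pR)).eval s' = if (⟨j, hj⟩ : Fin n) ∈ S then 1 else 0 := by
      simp only [Expr.eval, hjs]
      exact hS' ⟨j, hj⟩
    simp only [lastSat_succ hj, card_filter_lt_succ _ hj]
    -- A vertex that is not a candidate leaves the counter and the choice as they are.
    have hpass : ⟨j, hj⟩ ∉ outNbrs G S C → ∀ s'' : State, s''.reg cntR = s'.reg cntR →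
        s''.reg vR = s'.reg vR → (s''.setReg pR (j + 1)).reg cntR =
          2 + (#{y ∈ innerNbrs G S C | y.1 < j} +
            if (⟨j, hj⟩ : Fin n) ∈ innerNbrs G S C then 1 else 0) ∧
        (s''.setReg pR (j + 1)).reg vR = (if PointsAt G S C d ⟨j, hj⟩ then (⟨j, hj⟩ : Fin n)
          else lastSat (PointsAt G S C d) c j : Fin n) := by
      intro hn s'' h1 h2
      have hn1 : ¬ PointsAt G S C d ⟨j, hj⟩ := fun h => hn h.1
      have hn2 : ⟨j, hj⟩ ∉ innerNbrs G S C := fun h => hn (mem_innerNbrs.1 h).1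
      rw [if_neg hn1, if_neg hn2]
      simp [h1, h2, hI1, hI2]
    refine (Exec.ite (fun h1 => Exec.skip (hpass ?_ s' rfl rfl)) (fun h1 => Exec.seq ((exec_flagP
      hG' hC' (v := ⟨j, hj⟩) hjs (by decide) (by decide)).imp fun s₁ hf₁ h2 => Exec.ite
        (fun h3 => Exec.seq ((exec_degreeP (G := G) (S := S) (x := ⟨j, hj⟩) ?_ ?_ ?_).imp
          fun s₂ hf₂ h4 => Exec.ite
            (fun h5 => Exec.seq (Exec.ite (fun h6 => Exec.skip (Exec.set ?_))
              (fun h6 => Exec.set (Exec.set ?_))))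
            (fun h5 => Exec.ite (fun h6 => Exec.skip ?_) (fun h6 => Exec.set ?_))))
        (fun h3 => Exec.skip (hpass ?_ s₁ (hf₁.reg cntR rfl) (hf₁.reg vR rfl)))))).mono
          (by simp only [Expr.cost]; omega)
    · rw [hSj] at h1
      simp only [ne_eq, ite_eq_right_iff, one_ne_zero, imp_false, not_not] at h1
      exact fun h => (mem_outNbrs.1 h).1 h1
    · exact hG'.congr (hf₁.reg nR rfl) (hf₁.arr adjA rfl) (hf₁.arr rowA rfl)
    · rw [hf₁.arr setA rfl]; exact hS'
    · rw [hf₁.reg pR rfl]; exact hjs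
    case refine_9 =>
      simp only [Expr.eval, h2, ite_eq_right_iff, one_ne_zero, imp_false] at h3
      exact fun h => h3 (mem_outNbrs.1 h).2
    all_goals
      rw [hSj] at h1
      simp only [ite_eq_right_iff, one_ne_zero, imp_false] at h1
      simp only [Expr.eval, h2, ne_eq, ite_eq_right_iff, one_ne_zero, imp_false, not_not] at h3
      have hout : (⟨j, hj⟩ : Fin n) ∈ outNbrs G S C := mem_outNbrs.2 ⟨h1, h3⟩
      have hcnt₂ : s₂.reg cntR = 2 + #{y ∈ innerNbrs G S C | y.1 < j} := by
        rw [hf₂.reg cntR rfl, hf₁.reg cntR rfl, hI1]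
      have hv₂ : s₂.reg vR = lastSat (PointsAt G S C d) c j := by
        rw [hf₂.reg vR rfl, hf₁.reg vR rfl, hI2]
      have hp₂ : s₂.reg pR = j := by rw [hf₂.reg pR rfl, hf₁.reg pR rfl, hjs]
      have hd₂ : s₂.reg dR = d := by rw [hf₂.reg dR rfl, hf₁.reg dR rfl, hds']
      simp only [Expr.eval, h4, hd₂, hcnt₂] at h5 h6
      have hpend : Pendant G S ⟨j, hj⟩ ↔ weightedDegree G S ⟨j, hj⟩ ≤ 1 := Iff.rfl
      have hin : (⟨j, hj⟩ : Fin n) ∈ innerNbrs G S C ↔ ¬ weightedDegree G S ⟨j, hj⟩ ≤ 1 := by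
        rw [mem_innerNbrs, hpend, and_iff_right hout]
      have hpt : PointsAt G S C d ⟨j, hj⟩ ↔ (weightedDegree G S ⟨j, hj⟩ ≤ 1 ∧ d = 1) ∨
          (¬ weightedDegree G S ⟨j, hj⟩ ≤ 1 ∧ d = 2 + #{y ∈ innerNbrs G S C | y.1 < j}) := by
        rw [PointsAt, hpend, and_iff_right hout]
    · rw [if_pos (hin.2 (by omega)), if_neg (hpt.not.2 (by omega))]
      simp [Expr.eval, hcnt₂, hv₂]
      omega
    · rw [if_pos (hin.2 (by omega)), if_pos (hpt.2 (by omega))]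
      simp [Expr.eval, hcnt₂, hp₂]
      omega
    · rw [if_neg (hin.not.2 (by omega)), if_neg (hpt.not.2 (by omega))]
      simp [hcnt₂, hv₂]
    · rw [if_neg (hin.not.2 (by omega)), if_pos (hpt.2 (by omega))]
      simp [Expr.eval, hcnt₂, hp₂]
  · simp only [Expr.cost]; nlinarith
  · exact fun s' _ h => h.2

/-- Empties the set stored in the array `C`. -/
def clearP (C : ℕ) : Program := forUp iR nR (.put C (.var iR) (.const 0))

theorem exec_clearP {s : State} (hn : s.reg nR = n) (C : ℕ) :
    Exec (clearP C) s (20 * (n + 1)) fun s' => IsIndicator (n := n) (s'.arr C) ∅ := by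
  refine (Exec.forUp (N := n) (T := 3) (fun j s' => ∀ i < j, s'.arr C i = 0) hn (by decide)
    rfl rfl ?_ ?_).mono ?_ |>.imp ?_
  · simp
  · intro j s' hj hjs _ _ hI
    refine Exec.put ?_
    intro i hi
    by_cases hij : i = j
    · simp [Expr.eval, hjs, hij]
    · simp [Expr.eval, hjs, hij, hI i (by omega)]
  · omega
  · intro s' _ h v
    simpa using h v v.2

/-- Stores in the array `C` the set whose only element is the vertex in the register `x`. -/
def singletonP (C x : ℕ) : Program := .seq (clearP C) (.put C (.var x) (.const 1))

theorem exec_singletonP {s : State} (hn : s.reg nR = n) (C : ℕ) {x : ℕ} {v : Fin n}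
    (hx : s.reg x = v) (hxi : x ≠ iR) :
    Exec (singletonP C x) s (30 * (n + 1)) fun s' => IsIndicator (s'.arr C) {v} := by
  refine (Exec.seq ((exec_clearP hn C).imp fun s' hf h => Exec.put ?_)).mono
    (by simp only [Expr.cost]; omega)
  rw [← insert_empty_eq]
  refine h.insert fun i => ?_
  have : s'.reg x = v := by rw [hf.reg x (by simp [clearP, forUp, modReg, hxi]), hx]
  simp [Expr.eval, this]

/-- Copies the set stored in `setA` to `srcA`. -/
def copyP : Program := forUp iR nR (.put srcA (.var iR) (.get setA (.var iR)))

theorem exec_copyP {s : State} (hn : s.reg nR = n) {S : Finset (Fin n)}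
    (hS : IsIndicator (s.arr setA) S) :
    Exec copyP s (20 * (n + 1)) fun s' => IsIndicator (s'.arr srcA) S := by
  refine (Exec.forUp (N := n) (T := 4) (fun j s' => ∀ i < j, s'.arr srcA i = s.arr setA i) hn
    (by decide) rfl rfl ?_ ?_).mono ?_ |>.imp ?_
  · simp
  · intro j s' hj hjs _ ha hI
    refine Exec.put ?_
    intro i hi
    by_cases hij : i = j
    · simp [Expr.eval, hjs, hij, ha setA rfl]
    · simp [Expr.eval, hjs, hij, hI i (by omega)]
  · omega
  · intro s' _ h v
    rw [h v v.2]
    exact hS v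

/-- Sets the register `dR` to the remainder and the register `codeR` to the quotient of the division
of `codeR` by `baseR`. -/
def digitP : Program :=
  .seq (.set qR (.const 0)) (.seq
    (.loop (.sub (.add (.var codeR) (.const 1)) (.var baseR))
      (.seq (.set codeR (.sub (.var codeR) (.var baseR))) (.set qR (.add (.var qR) (.const 1)))))
    (.seq (.set dR (.var codeR)) (.set codeR (.var qR))))

theorem exec_digitP {s : State} {B m : ℕ} (hB : 0 < B) (hs : s.reg baseR = B)
    (hm : s.reg codeR = m) :
    Exec digitP s (30 * (m + 1)) fun s' => s'.reg dR = m % B ∧ s'.reg codeR = m / B := by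
  have h := Exec.loop (e := .sub (.add (.var codeR) (.const 1)) (.var baseR)) (T := 8)
    (p := .seq (.set codeR (.sub (.var codeR) (.var baseR))) (.set qR (.add (.var qR) (.const 1))))
    (s := s.setReg qR 0) (fun s' => s'.reg codeR + B * s'.reg qR = m) (fun s' => s'.reg codeR)
    (by simp [hm]) (by
      intro s' hf hI h
      have hb : s'.reg baseR = B := by rw [hf.reg baseR rfl]; simp [hs]
      simp only [Expr.eval, hb] at h
      refine (Exec.seq (Exec.set (Exec.set ?_))).mono (by simp [Expr.cost])
      simp only [Expr.eval, hb, reg_setReg]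
      simp only [Nat.reduceEqDiff, if_true, if_false]
      refine ⟨?_, by omega⟩
      rw [mul_add]
      omega)
  refine (Exec.seq (Exec.set (Exec.seq (h.imp fun s' hf hI => Exec.seq (Exec.set
    (Exec.set ?_)))))).mono ?_
  · obtain ⟨h1, h2⟩ := hI
    have hb : s'.reg baseR = B := by rw [hf.reg baseR rfl]; simp [hs]
    simp only [Expr.eval, hb] at h2
    have hlt : s'.reg codeR < B := by omega
    simp only [Expr.eval, reg_setReg]
    simp only [Nat.reduceEqDiff, if_true, if_false]
    rw [← h1, Nat.add_mul_mod_self_left, Nat.mod_eq_of_lt hlt, Nat.add_mul_div_left _ _ hB,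
      Nat.div_eq_of_lt hlt]
    simp
  · simp [Expr.cost, hm]
    omega

/-- One step of the walk. -/
def walkP : Program :=
  .seq digitP (.ite (.var dR) (.seq pickP (singletonP srcA vR)) .skip)

theorem exec_walkP {s : State} (hG : HasGraph G s) {S : Finset (Fin n)} {B M : ℕ} {w : Walker n}
    (hS : IsIndicator (s.arr setA) S) (hB : 0 < B) (hb : s.reg baseR = B)
    (hw₁ : IsIndicator (s.arr srcA) w.source) (hw₂ : s.reg vR = w.last)
    (hw₃ : s.reg codeR = w.code) (hM : w.code ≤ M) :
    Exec walkP s (300 * (M + 1) * (n + 1) ^ 2) fun s' =>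
      IsIndicator (s'.arr srcA) (walkStep G S B w).source ∧
      s'.reg vR = (walkStep G S B w).last ∧ s'.reg codeR = (walkStep G S B w).code := by
  refine (Exec.seq ((exec_digitP hB hb hw₃).imp fun s₁ hf₁ h1 => Exec.ite
    (fun h2 => Exec.seq ((exec_pickP (G := G) (S := S) (C := w.source) (d := w.code % B)
      (c := w.last) ?_ ?_ ?_ ?_ h1.1 ?_).imp fun s₂ hf₂ h3 =>
        (exec_singletonP (n := n) ?_ srcA h3 (by decide)).imp ?_))
    (fun h2 => Exec.skip ?_))).mono ?_
  · exact hG.congr (hf₁.reg nR rfl) (hf₁.arr adjA rfl) (hf₁.arr rowA rfl)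
  · rw [hf₁.arr setA rfl]; exact hS
  · rw [hf₁.arr srcA rfl]; exact hw₁
  · simp only [Expr.eval, h1.1] at h2
    omega
  · rw [hf₁.reg vR rfl, hw₂]
  · rw [hf₂.reg nR rfl, hf₁.reg nR rfl, hG.reg_n]
  · intro s₃ hf₃ h4
    simp only [Expr.eval, h1.1] at h2
    rw [walkStep, if_neg h2]
    refine ⟨h4, ?_, ?_⟩
    · rw [hf₃.reg vR rfl, h3]
    · rw [hf₃.reg codeR rfl, hf₂.reg codeR rfl, h1.2]
  · simp only [Expr.eval, h1.1] at h2
    rw [walkStep, if_pos h2]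
    refine ⟨?_, ?_, h1.2⟩
    · rw [hf₁.arr srcA rfl]; exact hw₁
    · rw [hf₁.reg vR rfl, hw₂]
  · simp only [Expr.cost]
    nlinarith [Nat.zero_le (M * n), Nat.zero_le (M * n ^ 2)]

theorem code_iterate_walkStep_le (S : Finset (Fin n)) (B r : ℕ) (w : Walker n) :
    ((walkStep G S B)^[r] w).code ≤ w.code := by
  induction r with
  | zero => exact le_rfl
  | succ r ih =>
    rw [Function.iterate_succ_apply']
    refine le_trans ?_ ih
    generalize (walkStep G S B)^[r] w = w'
    rw [walkStep]
    split_ifs <;> exact Nat.div_le_self _ _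

/-- One step of the search. -/
def searchP : Program :=
  .seq thinP (.seq (.ite (.var foundR) .skip (.seq copyP (forUp wR lenR walkP)))
    (.seq (.put setA (.var vR) (.const 1))
      (.seq countP (.set costR (.add (.var costR) (.var cR))))))

theorem exec_walks {s : State} (hG : HasGraph G s) {S : Finset (Fin n)} {B M r : ℕ} {a : Fin n}
    {m : ℕ} (hS : IsIndicator (s.arr setA) S) (hB : 0 < B) (hb : s.reg baseR = B)
    (hr : s.reg lenR = r) (hv : s.reg vR = a) (hm : s.reg codeR = m) (hM : m ≤ M) :
    Exec (.seq copyP (forUp wR lenR walkP)) s (400 * (r + 1) * (M + 1) * (n + 1) ^ 2) fun s' =>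
      s'.reg vR = ((walkStep G S B)^[r] ⟨S, a, m⟩).last ∧
      s'.reg codeR = ((walkStep G S B)^[r] ⟨S, a, m⟩).code := by
  refine (Exec.seq ((exec_copyP hG.reg_n hS).imp fun s₁ hf₁ h1 =>
    Exec.forUp (N := r) (T := 300 * (M + 1) * (n + 1) ^ 2) (fun j s' =>
      IsIndicator (s'.arr srcA) ((walkStep G S B)^[j] ⟨S, a, m⟩).source ∧
      s'.reg vR = ((walkStep G S B)^[j] ⟨S, a, m⟩).last ∧
      s'.reg codeR = ((walkStep G S B)^[j] ⟨S, a, m⟩).code) ?_ (by decide) rfl rfl ?_ ?_)).mono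
        ?_ |>.imp ?_
  · rw [hf₁.reg lenR rfl, hr]
  · refine ⟨by simpa using h1, ?_, ?_⟩
    · simp [hf₁.reg vR rfl, hv]
    · simp [hf₁.reg codeR rfl, hm]
  · rintro j s' hj hjs hr ha ⟨h2, h3, h4⟩
    rw [Function.iterate_succ_apply']
    refine (exec_walkP (G := G) (S := S) (B := B) (M := M) ?_ ?_ hB ?_ h2 h3 h4
      ((code_iterate_walkStep_le _ _ _ _).trans hM)).imp fun s'' _ h => by simpa using h
    · exact hG.congr ((hr nR rfl (by decide)).trans (hf₁.reg nR rfl))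
        ((ha adjA rfl).trans (hf₁.arr adjA rfl)) ((ha rowA rfl).trans (hf₁.arr rowA rfl))
    · rw [ha setA rfl, hf₁.arr setA rfl]; exact hS
    · rw [hr baseR rfl (by decide), hf₁.reg baseR rfl, hb]
  · have h1 : 1 ≤ (M + 1) * (n + 1) ^ 2 := Nat.one_le_iff_ne_zero.2 (by positivity)
    have h2 : n + 1 ≤ (M + 1) * (n + 1) ^ 2 := by nlinarith [Nat.zero_le (M * (n + 1) ^ 2)]
    rw [mul_assoc 300, mul_assoc (400 * (r + 1))]
    generalize (M + 1) * (n + 1) ^ 2 = Y at *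
    nlinarith
  · exact fun s' _ h => h.2

theorem exec_searchP {s : State} (hG : HasGraph G s) {B M r : ℕ} {a : Fin n} {z : Search n}
    (hS : IsIndicator (s.arr setA) z.done) (hB : 0 < B) (hb : s.reg baseR = B)
    (hr : s.reg lenR = r) (hv : s.reg startR = a) (hc : s.reg costR = z.cost)
    (hm : s.reg codeR = z.code) (hM : z.code ≤ M) :
    Exec searchP s (1000 * (r + 1) * (M + 1) * (n + 1) ^ 3) fun s' =>
      IsIndicator (s'.arr setA) (searchStep G B r a z).done ∧
      s'.reg costR = (searchStep G B r a z).cost ∧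
      s'.reg codeR = (searchStep G B r a z).code := by
  classical
  have hmid : ∀ s₁, Frame thinP s s₁ → (IsIndicator (s₁.arr setA) z.done ∧
      s₁.reg vR = lastSat (ThinAt G z.done) a n ∧
      s₁.reg foundR = if ∃ v, ThinAt G z.done v then 1 else 0) →
      Exec (.ite (.var foundR) .skip (.seq copyP (forUp wR lenR walkP))) s₁
        (500 * (r + 1) * (M + 1) * (n + 1) ^ 2) fun s₂ =>
        s₂.reg vR = (nextVertex G B r a z.done z.code).1 ∧
        s₂.reg codeR = (nextVertex G B r a z.done z.code).2 := by
    rintro s₁ hf₁ ⟨h1, h2, h3⟩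
    rw [nextVertex]
    refine (Exec.ite (fun h4 => Exec.skip ?_) (fun h4 => (exec_walks (G := G) (S := z.done)
      (B := B) (M := M) (r := r) (a := a) (m := z.code) ?_ h1 hB ?_ ?_ ?_ ?_ hM).imp
        fun s₂ hf₂ h5 => ?_)).mono ?_
    · simp only [Expr.eval, h3, ne_eq, ite_eq_right_iff, one_ne_zero, imp_false, not_not] at h4
      rw [if_pos h4]
      exact ⟨h2, by rw [hf₁.reg codeR rfl, hm]⟩
    · exact hG.congr (hf₁.reg nR rfl) (hf₁.arr adjA rfl) (hf₁.arr rowA rfl)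
    · rw [hf₁.reg baseR rfl, hb]
    · rw [hf₁.reg lenR rfl, hr]
    · simp only [Expr.eval, h3, ite_eq_right_iff, one_ne_zero, imp_false] at h4
      rw [h2, lastSat_eq_of_forall_not (not_exists.1 h4)]
    · rw [hf₁.reg codeR rfl, hm]
    · simp only [Expr.eval, h3, ite_eq_right_iff, one_ne_zero, imp_false] at h4
      rw [if_neg h4]
      exact h5
    · have h1 : 1 ≤ (r + 1) * ((M + 1) * (n + 1) ^ 2) := Nat.one_le_iff_ne_zero.2 (by positivity)
      simp only [Expr.cost, mul_assoc] at *
      omega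
  refine (Exec.seq ((exec_thinP hG hS hv).imp fun s₁ hf₁ h1 => Exec.seq ((hmid s₁ hf₁ h1).imp
    fun s₂ hf₂ h2 => Exec.seq (Exec.put (Exec.seq ((exec_countP (G := G)
      (S := insert (nextVertex G B r a z.done z.code).1 z.done) ?_ ?_).imp fun s₃ hf₃ h3 =>
        Exec.set ?_)))))).mono ?_
  · refine hG.congr ?_ ?_ ?_
    · rw [reg_setArr, hf₂.reg nR rfl, hf₁.reg nR rfl]
    · funext i; simp [hf₂.arr adjA rfl, hf₁.arr adjA rfl]
    · funext i; simp [hf₂.arr rowA rfl, hf₁.arr rowA rfl]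
  · refine h1.1.insert fun i => ?_
    simp [Expr.eval, h2.1, hf₂.arr setA rfl]
  · refine ⟨?_, ?_, ?_⟩
    · rw [arr_setReg, hf₃.arr setA rfl]
      refine h1.1.insert fun i => ?_
      simp [Expr.eval, h2.1, hf₂.arr setA rfl]
    · simp [Expr.eval, h3, hf₃.reg costR rfl, hf₂.reg costR rfl, hf₁.reg costR rfl, hc, searchStep]
    · simp [hf₃.reg codeR rfl, h2.2, searchStep]
  · have h1 : 1 ≤ (r + 1) * (M + 1) := Nat.one_le_iff_ne_zero.2 (by positivity)
    simp only [Expr.cost]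
    rw [mul_assoc 500, mul_assoc 1000]
    generalize (r + 1) * (M + 1) = Y at *
    have h2 : (n + 1) ^ 2 ≤ (n + 1) ^ 3 := Nat.pow_le_pow_right (by omega) (by omega)
    have h3 : 1 ≤ (n + 1) ^ 2 := Nat.one_le_iff_ne_zero.2 (by positivity)
    generalize (n + 1) ^ 2 = X2 at *
    generalize (n + 1) ^ 3 = X3 at *
    have h4 : Y * X2 ≤ Y * X3 := Nat.mul_le_mul_left _ h2
    have h5 : X3 ≤ Y * X3 := Nat.le_mul_of_pos_left _ h1
    rw [mul_assoc, mul_assoc]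
    omega

end Step

/-! ### The decision procedure -/

section Decision

variable {n : ℕ} {G : SimpleGraph (Fin n)}

/-- Sets the register `okR` to `1` if the set stored in the array `C` contains all vertices, and to
`0` otherwise. -/
def fullP (C : ℕ) : Program :=
  .seq (.set okR (.const 1))
    (forUp iR nR (.ite (.get C (.var iR)) .skip (.set okR (.const 0))))

theorem exec_fullP {s : State} (hn : s.reg nR = n) {C : ℕ} {S : Finset (Fin n)}
    (hS : IsIndicator (s.arr C) S) :
    Exec (fullP C) s (30 * (n + 1)) fun s' => s'.reg okR = if S = univ then 1 else 0 := by
  classical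
  refine (Exec.seq (Exec.set (Exec.forUp (N := n) (T := 8) (fun j s' =>
    s'.reg okR = if ∀ v : Fin n, v.1 < j → v ∈ S then 1 else 0) ?_ (by decide) rfl rfl ?_ ?_))).mono
      ?_ |>.imp ?_
  · simp [hn]
  · simp [Expr.eval]
  · intro j s' hj hjs hr ha hI
    have hSj : (Expr.get C (.var iR)).eval s' = if (⟨j, hj⟩ : Fin n) ∈ S then 1 else 0 := by
      simp only [Expr.eval, hjs]
      rw [ha C rfl]
      exact hS ⟨j, hj⟩
    refine (Exec.ite (fun h1 => Exec.skip ?_) (fun h1 => Exec.set ?_)).mono (by simp [Expr.cost])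
    · rw [hSj] at h1
      simp only [ne_eq, ite_eq_right_iff, one_ne_zero, imp_false, not_not] at h1
      have hiff : (∀ v : Fin n, v.1 < j + 1 → v ∈ S) ↔ ∀ v : Fin n, v.1 < j → v ∈ S := by
        refine ⟨fun h v hv => h v (by omega), fun h v hv => ?_⟩
        rcases Nat.lt_succ_iff_lt_or_eq.1 hv with hv | hv
        · exact h v hv
        · obtain rfl : v = ⟨j, hj⟩ := Fin.ext hv
          exact h1
      simp only [hiff]
      simpa using hI
    · rw [hSj] at h1
      simp only [ite_eq_right_iff, one_ne_zero, imp_false] at h1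
      rw [if_neg fun h => h1 (h ⟨j, hj⟩ (Nat.lt_succ_self j))]
      simp [Expr.eval]
  · simp only [Expr.cost]; omega
  · intro s' _ h
    rw [h]
    simp [eq_univ_iff_forall]

/-- The search for the parameter `k` with first vertex `a` and code `m` finds an ordering of small
profile. -/
def Succeeds (G : SimpleGraph (Fin n)) (k : ℕ) (a : Fin n) (m : ℕ) : Prop :=
  ((searchStep G (2 * k + 6) (k + 2) a)^[n] (searchInit G a m)).done = univ ∧
    ((searchStep G (2 * k + 6) (k + 2) a)^[n] (searchInit G a m)).cost ≤ n - 1 + k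

/-- A complete run of the search, with first vertex in the register `startR` and code in the
register `roundR`. -/
def runP : Program :=
  .seq (singletonP setA startR) (.seq (.set codeR (.var roundR)) (.seq countP
    (.seq (.set costR (.var cR)) (.seq (forUp stepR nR searchP) (.seq (fullP setA)
      (.ite (.var okR) (.ite (.sub (.add (.var costR) (.const 1)) (.add (.var nR) (.var kR))) .skip
        (.set resR (.const 1))) .skip))))))

theorem code_searchStep_le (B r : ℕ) (a : Fin n) (z : Search n) :
    (searchStep G B r a z).code ≤ z.code := by
  simp only [searchStep, nextVertex]
  split_ifs
  · exact le_rfl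
  · exact code_iterate_walkStep_le _ _ _ _

theorem code_iterate_searchStep_le (B r : ℕ) (a : Fin n) (z : Search n) (i : ℕ) :
    ((searchStep G B r a)^[i] z).code ≤ z.code := by
  induction i with
  | zero => exact le_rfl
  | succ i ih =>
    rw [Function.iterate_succ_apply']
    exact (code_searchStep_le _ _ _ _).trans ih

/-- The parameter and the quantities computed from it are in memory. -/
structure HasParam (k : ℕ) (s : State) : Prop where
  reg_k : s.reg kR = k
  reg_base : s.reg baseR = 2 * k + 6
  reg_len : s.reg lenR = k + 2

theorem HasParam.congr {k : ℕ} {s s' : State} (h : HasParam k s) (h1 : s'.reg kR = s.reg kR)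
    (h2 : s'.reg baseR = s.reg baseR) (h3 : s'.reg lenR = s.reg lenR) : HasParam k s' :=
  ⟨h1.trans h.reg_k, h2.trans h.reg_base, h3.trans h.reg_len⟩

open Classical in
theorem exec_runP {s : State} (hG : HasGraph G s) {k m M : ℕ} {a : Fin n} (hk : HasParam k s)
    (ha : s.reg startR = a) (hm : s.reg roundR = m) (hM : m ≤ M) :
    Exec runP s (2000 * (k + 3) * (M + 1) * (n + 1) ^ 4) fun s' =>
      s'.reg resR = if Succeeds G k a m then 1 else s.reg resR := by
  have hn := hG.reg_n
  have hpos : 0 < n := a.pos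
  refine (Exec.seq ((exec_singletonP hn setA ha (by decide)).imp fun s₁ hf₁ h1 => Exec.seq
    (Exec.set (Exec.seq ((exec_countP (G := G) (S := {a}) ?_ ?_).imp fun s₂ hf₂ h2 => Exec.seq
      (Exec.set (Exec.seq ((Exec.forUp (N := n) (T := 1000 * (k + 3) * (M + 1) * (n + 1) ^ 3)
        (fun j s' =>
          IsIndicator (s'.arr setA)
            ((searchStep G (2 * k + 6) (k + 2) a)^[j] (searchInit G a m)).done ∧
          s'.reg costR = ((searchStep G (2 * k + 6) (k + 2) a)^[j] (searchInit G a m)).cost ∧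
          s'.reg codeR = ((searchStep G (2 * k + 6) (k + 2) a)^[j] (searchInit G a m)).code)
        ?_ (by decide) rfl rfl ?_ ?_).imp fun s₃ hf₃ h3 => Exec.seq ((exec_fullP ?_ h3.1).imp
          fun s₄ hf₄ h4 => Exec.ite (fun h5 => Exec.ite (fun h6 => Exec.skip ?_)
            (fun h6 => Exec.set ?_)) (fun h5 => Exec.skip ?_)))))))))).mono ?_
  · exact hG.congr (hf₁.reg nR rfl) (hf₁.arr adjA rfl) (hf₁.arr rowA rfl)
  · exact h1
  · simp [hf₂.reg nR rfl, hf₁.reg nR rfl, hn]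
  · refine ⟨?_, ?_, ?_⟩
    · simpa [hf₂.arr setA rfl, searchInit] using h1
    · simpa [Expr.eval, searchInit] using h2
    · simp [Expr.eval, searchInit, hf₂.reg codeR rfl, hf₁.reg roundR rfl, hm]
  · rintro j s' hj hjs hr ha' ⟨h3, h4, h5⟩
    rw [Function.iterate_succ_apply']
    refine (exec_searchP (G := G) (B := 2 * k + 6) (M := M) (r := k + 2) (a := a) ?_ h3
      (by omega) ?_ ?_ ?_ h4 h5 ((code_iterate_searchStep_le _ _ _ _ _).trans hM)).imp fun s'' _ h => by simpa using h
    · exact hG.congr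
        (by rw [hr nR rfl (by decide)]; simp [hf₂.reg nR rfl, hf₁.reg nR rfl])
        (by rw [ha' adjA rfl]; simp [hf₂.arr adjA rfl, hf₁.arr adjA rfl])
        (by rw [ha' rowA rfl]; simp [hf₂.arr rowA rfl, hf₁.arr rowA rfl])
    · rw [hr baseR rfl (by decide)]
      simp [hf₂.reg baseR rfl, hf₁.reg baseR rfl, hk.reg_base]
    · rw [hr lenR rfl (by decide)]
      simp [hf₂.reg lenR rfl, hf₁.reg lenR rfl, hk.reg_len]
    · rw [hr startR rfl (by decide)]
      simp [hf₂.reg startR rfl, hf₁.reg startR rfl, ha]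
  · simp [hf₃.reg nR rfl, hf₂.reg nR rfl, hf₁.reg nR rfl, hn]
  pick_goal 4
  · have h1 : 1 ≤ (k + 3) * (M + 1) := Nat.one_le_iff_ne_zero.2 (by positivity)
    simp only [Expr.cost]
    rw [mul_assoc 1000, mul_assoc 2000]
    generalize (k + 3) * (M + 1) = Y at *
    have h2 : (n + 1) ≤ (n + 1) ^ 4 := Nat.le_self_pow (by omega) _
    have h3 : (n + 1) ^ 2 ≤ (n + 1) ^ 4 := Nat.pow_le_pow_right (by omega) (by omega)
    have h4 : (n + 1) * (1000 * Y * (n + 1) ^ 3 + 10) =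
      1000 * (Y * (n + 1) ^ 4) + 10 * (n + 1) := by ring
    rw [h4, mul_assoc 2000]
    generalize (n + 1) ^ 2 = X2 at *
    generalize (n + 1) ^ 4 = X4 at *
    have h5 : X4 ≤ Y * X4 := Nat.le_mul_of_pos_left _ h1
    omega
  all_goals
    have hres : s₄.reg resR = s.reg resR := by
      simp [hf₄.reg resR rfl, hf₃.reg resR rfl, hf₂.reg resR rfl, hf₁.reg resR rfl]
    have hn₄ : s₄.reg nR = n := by
      simp [hf₄.reg nR rfl, hf₃.reg nR rfl, hf₂.reg nR rfl, hf₁.reg nR rfl, hn]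
    have hk₄ : s₄.reg kR = k := by
      simp [hf₄.reg kR rfl, hf₃.reg kR rfl, hf₂.reg kR rfl, hf₁.reg kR rfl, hk.reg_k]
    have hc₄ := (hf₄.reg costR rfl).trans h3.2.1
    simp only [Expr.eval, h4, ne_eq, ite_eq_right_iff, one_ne_zero, imp_false, not_not] at h5
  -- The test `cost + 1 ≤ n + k` is equivalent to `cost ≤ n - 1 + k` because `n` is positive.
  · simp only [Expr.eval, hn₄, hk₄, hc₄] at h6
    rw [if_neg fun h => by have := h.2; omega, hres]
  · simp only [Expr.eval, hn₄, hk₄, hc₄] at h6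
    rw [if_pos ⟨h5, by omega⟩]
    simp [Expr.eval]
  · rw [if_neg fun h => h5 h.1, hres]

/-- Sets the register `resR` to `1` if some run of the search succeeds. -/
def allRunsP : Program := forUp startR nR (forUp roundR boundR runP)

open Classical in
theorem exec_allRunsP {s : State} (hG : HasGraph G s) {k M : ℕ} (hk : HasParam k s)
    (hM : s.reg boundR = M) (hres : s.reg resR = 0) :
    Exec allRunsP s (4000 * (k + 3) * (M + 1) ^ 2 * (n + 1) ^ 5) fun s' =>
      s'.reg resR = if ∃ a, ∃ m < M, Succeeds G k a m then 1 else 0 := by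
  refine (Exec.forUp (N := n) (T := (M + 1) * (2000 * (k + 3) * (M + 1) * (n + 1) ^ 4 + 10))
    (fun j s' => s'.reg resR = if ∃ a, a.1 < j ∧ ∃ m < M, Succeeds G k a m then 1 else 0)
    hG.reg_n (by decide) rfl rfl ?_ ?_).mono ?_ |>.imp ?_
  · simp [hres]
  · intro j s₁ hj hjs hr ha hI
    refine (Exec.forUp (N := M) (T := 2000 * (k + 3) * (M + 1) * (n + 1) ^ 4) (fun i s' =>
      s'.reg resR = if (∃ a, a.1 < j ∧ ∃ m < M, Succeeds G k a m) ∨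
        ∃ m < i, Succeeds G k ⟨j, hj⟩ m then 1 else 0) ?_ (by decide) rfl rfl ?_ ?_).imp ?_
    · rw [hr boundR rfl (by decide), hM]
    · simpa using hI
    · intro i s₂ hi his hr₂ ha₂ hI₂
      refine (exec_runP (G := G) (k := k) (m := i) (M := M) (a := ⟨j, hj⟩) ?_ ?_ ?_ his
        hi.le).imp fun s₃ hf₃ h3 => ?_
      · exact hG.congr ((hr₂ nR rfl (by decide)).trans (hr nR rfl (by decide)))
          ((ha₂ adjA rfl).trans (ha adjA rfl)) ((ha₂ rowA rfl).trans (ha rowA rfl))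
      · exact hk.congr ((hr₂ kR rfl (by decide)).trans (hr kR rfl (by decide)))
          ((hr₂ baseR rfl (by decide)).trans (hr baseR rfl (by decide)))
          ((hr₂ lenR rfl (by decide)).trans (hr lenR rfl (by decide)))
      · rw [hr₂ startR rfl (by decide), hjs]
      · have hiff : (∃ m < i + 1, Succeeds G k ⟨j, hj⟩ m) ↔
            Succeeds G k ⟨j, hj⟩ i ∨ ∃ m < i, Succeeds G k ⟨j, hj⟩ m := by
          constructor
          · rintro ⟨m, hm, h⟩
            rcases Nat.lt_succ_iff_lt_or_eq.1 hm with hm | rfl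
            · exact Or.inr ⟨m, hm, h⟩
            · exact Or.inl h
          · rintro (h | ⟨m, hm, h⟩)
            · exact ⟨i, Nat.lt_succ_self i, h⟩
            · exact ⟨m, by omega, h⟩
        simp only [reg_setReg, hiff, h3, hI₂]
        by_cases h : Succeeds G k ⟨j, hj⟩ i <;> simp [h]
    · intro s' _ h
      have hiff : (∃ a : Fin n, a.1 < j + 1 ∧ ∃ m < M, Succeeds G k a m) ↔
          (∃ a : Fin n, a.1 < j ∧ ∃ m < M, Succeeds G k a m) ∨
            ∃ m < M, Succeeds G k ⟨j, hj⟩ m := by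
        constructor
        · rintro ⟨a, ha, h⟩
          rcases Nat.lt_succ_iff_lt_or_eq.1 ha with ha | ha
          · exact Or.inl ⟨a, ha, h⟩
          · obtain rfl : a = ⟨j, hj⟩ := Fin.ext ha
            exact Or.inr h
        · rintro (⟨a, ha, h⟩ | h)
          · exact ⟨a, by omega, h⟩
          · exact ⟨⟨j, hj⟩, Nat.lt_succ_self j, h⟩
      simp only [hiff]
      simpa using h
  · have h1 : 1 ≤ (k + 3) * (M + 1) ^ 2 := Nat.one_le_iff_ne_zero.2 (by positivity)
    have h2 : (n + 1) * ((M + 1) * (2000 * (k + 3) * (M + 1) * (n + 1) ^ 4 + 10) + 10) =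
      2000 * ((k + 3) * (M + 1) ^ 2 * (n + 1) ^ 5) + 10 * ((n + 1) * (M + 1)) + 10 * (n + 1) := by
      ring
    have h3 : (n + 1) * (M + 1) ≤ (k + 3) * (M + 1) ^ 2 * (n + 1) ^ 5 := by
      rw [mul_comm]
      refine Nat.mul_le_mul ?_ (Nat.le_self_pow (by omega) _)
      exact (Nat.le_self_pow (by omega) _).trans (Nat.le_mul_of_pos_left _ (by omega))
    have h4 : n + 1 ≤ (n + 1) * (M + 1) := Nat.le_mul_of_pos_right _ (by omega)
    rw [h2, mul_assoc 4000, mul_assoc 4000]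
    omega
  · intro s' _ h
    rw [h]
    simp

/-- Sets the register `okR` to `1` if the graph is connected, and to `0` otherwise. The register
`startR` holds the number of some vertex. -/
def connectedP : Program :=
  .seq (singletonP srcA startR) (.seq
    (forUp stepR nR (forUp zR nR
      (.seq (flagP srcA zR) (.ite (.var flR) (.put srcA (.var zR) (.const 1)) .skip))))
    (fullP srcA))

/-- One round of the connectivity test. The set grows while the round is under way, so that it may
gain more than the boundary of the set at the start. -/
theorem exec_connectedRound {s : State} (hG : HasGraph G s) {C : Finset (Fin n)}
    (hC : IsIndicator (s.arr srcA) C) {a : Fin n} (haC : ∀ x ∈ C, G.Reachable a x) :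
    Exec (forUp zR nR (.seq (flagP srcA zR) (.ite (.var flR) (.put srcA (.var zR) (.const 1))
      .skip))) s ((n + 1) * (40 * (n + 1) + 20)) fun s' => ∃ D : Finset (Fin n),
        IsIndicator (s'.arr srcA) D ∧ C ⊆ D ∧ (∀ x ∈ D, G.Reachable a x) ∧ bdry G C ⊆ D := by
  classical
  refine (Exec.forUp (N := n) (T := 40 * (n + 1) + 10) (fun j s' => ∃ D : Finset (Fin n),
    IsIndicator (s'.arr srcA) D ∧ C ⊆ D ∧ (∀ x ∈ D, G.Reachable a x) ∧
      ∀ x ∈ bdry G C, x.1 < j → x ∈ D) hG.reg_n (by decide) rfl rfl ?_ ?_).mono ?_ |>.imp ?_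
  · exact ⟨C, hC, Subset.rfl, haC, by simp⟩
  · rintro j s₁ hj hjs hr ha ⟨D, hD, hCD, haD, hbD⟩
    have hG₁ : HasGraph G s₁ := hG.congr (hr nR rfl (by decide)) (ha adjA rfl) (ha rowA rfl)
    refine (Exec.seq ((exec_flagP hG₁ hD (v := ⟨j, hj⟩) hjs (by decide) (by decide)).imp
      fun s₂ hf₂ h2 => Exec.ite (fun h3 => Exec.put ?_) (fun h3 => Exec.skip ?_))).mono
        (by simp only [Expr.cost]; omega)
    · simp only [Expr.eval, h2, ne_eq, ite_eq_right_iff, one_ne_zero, imp_false, not_not] at h3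
      obtain ⟨y, hy, hyj⟩ := h3
      refine ⟨insert ⟨j, hj⟩ D, ?_, hCD.trans (subset_insert _ _), ?_, ?_⟩
      · refine hD.insert fun i => ?_
        simp [Expr.eval, hf₂.arr srcA rfl, hf₂.reg zR rfl, hjs]
      · intro x hx
        rcases mem_insert.1 hx with rfl | hx
        · exact (haD y hy).trans hyj.reachable
        · exact haD x hx
      · intro x hx hxj
        rcases Nat.lt_succ_iff_lt_or_eq.1 hxj with h | h
        · exact mem_insert_of_mem (hbD x hx h)
        · exact mem_insert.2 (Or.inl (Fin.ext h))
    · simp only [Expr.eval, h2, ite_eq_right_iff, one_ne_zero, imp_false] at h3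
      refine ⟨D, ?_, hCD, haD, fun x hx hxj => ?_⟩
      · rw [arr_setReg, hf₂.arr srcA rfl]; exact hD
      · rcases Nat.lt_succ_iff_lt_or_eq.1 hxj with h | h
        · exact hbD x hx h
        · obtain rfl : x = ⟨j, hj⟩ := Fin.ext h
          obtain ⟨y, hy, hyx⟩ := (mem_outNbrs.1 hx).2
          exact absurd ⟨y, hCD hy, hyx⟩ h3
  · exact le_of_eq (by ring)
  · rintro s' _ ⟨D, h1, h2, h3, h4⟩
    exact ⟨D, h1, h2, h3, fun x hx => h4 x hx x.2⟩

open Classical in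
/-- In a connected graph every round adds a vertex, so `n` rounds reach all of them. -/
theorem exec_connectedP {s : State} (hG : HasGraph G s) {a : Fin n} (ha : s.reg startR = a) :
    Exec connectedP s (200 * (n + 1) ^ 3) fun s' =>
      s'.reg okR = if G.Connected then 1 else 0 := by
  have hn := hG.reg_n
  refine (Exec.seq ((exec_singletonP hn srcA ha (by decide)).imp fun s₁ hf₁ h1 => Exec.seq
    ((Exec.forUp (N := n) (T := (n + 1) * (40 * (n + 1) + 20)) (fun j s' =>
      ∃ C : Finset (Fin n), IsIndicator (s'.arr srcA) C ∧ C.Nonempty ∧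
        (∀ x ∈ C, G.Reachable a x) ∧ (G.Connected → C = univ ∨ j + 1 ≤ #C))
      ?_ (by decide) rfl rfl ?_ ?_).imp fun s₂ hf₂ h2 => ?_))).mono (T₂ := 200 * (n + 1) ^ 3)
        (T₁ := 30 * (n + 1) + ((n + 1) * ((n + 1) * (40 * (n + 1) + 20) + 10) + 30 * (n + 1))) ?_
  · rw [hf₁.reg nR rfl, hn]
  · exact ⟨{a}, by simpa using h1, by simp, by simp, by simp⟩
  · rintro j s₂ hj hjs hr ha' ⟨C, hC, hne, haC, hcard⟩
    refine (exec_connectedRound (G := G) (a := a) ?_ hC haC).imp ?_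
    · exact hG.congr ((hr nR rfl (by decide)).trans (hf₁.reg nR rfl))
        ((ha' adjA rfl).trans (hf₁.arr adjA rfl)) ((ha' rowA rfl).trans (hf₁.arr rowA rfl))
    · rintro s₃ _ ⟨D, h1, h2, h3, h4⟩
      refine ⟨D, h1, hne.mono h2, h3, fun hconn => ?_⟩
      rcases hcard hconn with h | h
      · exact Or.inl (univ_subset_iff.1 (h ▸ h2))
      · by_cases hu : C = univ
        · exact Or.inl (univ_subset_iff.1 (hu ▸ h2))
        · obtain ⟨x, hx⟩ := bdry_nonempty hconn hne hu
          have hlt : #C < #D := card_lt_card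
            ((ssubset_iff_of_subset h2).2 ⟨x, h4 hx, (mem_outNbrs.1 hx).1⟩)
          exact Or.inr (by omega)
  · obtain ⟨C, hC, hne, haC, hcard⟩ := h2
    refine (exec_fullP ?_ hC).imp fun s₃ _ h3 => ?_
    · rw [hf₂.reg nR rfl, hf₁.reg nR rfl, hn]
    · have hiff : C = univ ↔ G.Connected := by
        constructor
        · intro h
          refine (SimpleGraph.connected_iff_exists_forall_reachable G).2 ⟨a, fun x => ?_⟩
          exact haC x (h ▸ mem_univ x)
        · intro h
          rcases hcard h with h | h
          · exact h
          · have := card_le_univ C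
            rw [Fintype.card_fin] at this
            omega
      simp only [hiff] at h3
      exact h3
  · nlinarith [Nat.zero_le (n ^ 2), Nat.zero_le (n ^ 3)]

/-- Sets the register `nR` to the square root of the length of the input. -/
def sizeP : Program :=
  .loop (.sub (.var outR) (.var sqR))
    (.seq (.set sqR (.add (.var sqR) (.add (.var nR) (.add (.var nR) (.const 1)))))
      (.set nR (.add (.var nR) (.const 1))))

theorem exec_sizeP {s : State} (hlen : s.reg outR = n * n) (hn : s.reg nR = 0)
    (hsq : s.reg sqR = 0) : Exec sizeP s (20 * (n + 1)) fun s' => s'.reg nR = n := by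
  refine (Exec.loop (T := 13) (fun s' => s'.reg sqR = s'.reg nR * s'.reg nR ∧ s'.reg nR ≤ n)
    (fun s' => n - s'.reg nR) (by simp [hn, hsq]) ?_).mono ?_ |>.imp ?_
  · rintro s' hf ⟨h1, h2⟩ h3
    simp only [Expr.eval, hf.reg outR rfl, hlen, h1] at h3
    have hlt : s'.reg nR < n := by
      by_contra hge
      have := Nat.mul_le_mul (not_lt.1 hge) (not_lt.1 hge)
      omega
    refine (Exec.seq (Exec.set (Exec.set ?_))).mono (by simp [Expr.cost])
    simp only [Expr.eval, reg_setReg]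
    simp only [Nat.reduceEqDiff, if_true, if_false, h1]
    refine ⟨⟨by ring, by omega⟩, by omega⟩
  · simp only [Expr.cost, hn]; omega
  · rintro s' hf ⟨⟨h1, h2⟩, h3⟩
    simp only [Expr.eval, hf.reg outR rfl, hlen, h1] at h3
    refine le_antisymm h2 ?_
    by_contra hlt
    have := Nat.mul_lt_mul'' (not_le.1 hlt) (not_le.1 hlt)
    omega

/-- Stores the starting positions of the rows of the adjacency matrix. -/
def rowsP : Program :=
  .seq (.set expR (.const 0)) (forUp iR nR
    (.seq (.put rowA (.var iR) (.var expR)) (.set expR (.add (.var expR) (.var nR)))))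

theorem exec_rowsP {s : State} (hn : s.reg nR = n) :
    Exec rowsP s (30 * (n + 1)) fun s' => ∀ i < n, s'.arr rowA i = i * n := by
  refine (Exec.seq (Exec.set (Exec.forUp (N := n) (T := 10) (fun j s' => s'.reg expR = j * n ∧
    ∀ i < j, s'.arr rowA i = i * n) ?_ (by decide) rfl rfl ?_ ?_))).mono ?_ |>.imp ?_
  · simp [hn]
  · simp [Expr.eval]
  · rintro j s' hj hjs hr ha ⟨h1, h2⟩
    have hn' : s'.reg nR = n := by rw [hr nR rfl (by decide)]; simp [hn]
    refine (Exec.seq (Exec.put (Exec.set ?_))).mono (by simp [Expr.cost])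
    refine ⟨?_, fun i hi => ?_⟩
    · simp [Expr.eval, h1, hn']
      ring
    · by_cases hij : i = j
      · simp [Expr.eval, hij, hjs, h1]
      · simp [Expr.eval, hij, hjs, h2 i (by omega)]
  · simp only [Expr.cost]; omega
  · exact fun s' _ h => h.2

/-- Computes the quantities that depend only on the parameter: the base, the length of the walks,
and, by repeated doubling, the number of codes. -/
def paramP : Program :=
  .seq (.set baseR (.add (.add (.var kR) (.var kR)) (.const 6)))
    (.seq (.set lenR (.add (.var kR) (.const 2)))
    (.seq (.set cntR (.add (.add (.add (.var kR) (.var kR)) (.add (.var kR) (.var kR))) (.const 8)))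
    (.seq (.set qR (.const 1))
    (.seq (forUp iR cntR (.set qR (.add (.var qR) (.var qR))))
    (.seq (.set boundR (.const 1))
      (forUp iR qR (.set boundR (.add (.var boundR) (.var boundR)))))))))

theorem exec_paramP {s : State} {k : ℕ} (hk : s.reg kR = k) :
    Exec paramP s (200 * codeBound k) fun s' => HasParam k s' ∧ s'.reg boundR = codeBound k := by
  refine (Exec.seq (Exec.set (Exec.seq (Exec.set (Exec.seq (Exec.set (Exec.seq (Exec.set
    (Exec.seq ((Exec.forUp (N := 4 * k + 8) (T := 4) (fun j s' => s'.reg qR = 2 ^ j)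
      ?_ (by decide) rfl rfl ?_ ?_).imp fun s₁ hf₁ h1 => Exec.seq (Exec.set
        ((Exec.forUp (N := 2 ^ (4 * k + 8)) (T := 4) (fun j s' => s'.reg boundR = 2 ^ j)
          ?_ (by decide) rfl rfl ?_ ?_).imp fun s₂ hf₂ h2 => ⟨⟨?_, ?_, ?_⟩, h2⟩)))))))))))).mono ?_
  · simp [Expr.eval, hk]; ring
  · simp [Expr.eval]
  · intro j s' hj hjs hr ha hI
    refine Exec.set ?_
    simp [Expr.eval, hI, pow_succ]
    ring
  · simp [h1]
  · simp [Expr.eval]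
  · intro j s' hj hjs hr ha hI
    refine Exec.set ?_
    simp [Expr.eval, hI, pow_succ]
    ring
  · have h1 : 4 * k + 8 < 2 ^ (4 * k + 8) := Nat.lt_two_pow_self
    have h2 : 2 ^ (4 * k + 8) < codeBound k := Nat.lt_two_pow_self
    simp only [Expr.cost]
    omega
  · simp [hf₂.reg kR rfl, hf₁.reg kR rfl, hk]
  · simp [hf₂.reg baseR rfl, hf₁.reg baseR rfl, hk, Expr.eval]; ring
  · simp [hf₂.reg lenR rfl, hf₁.reg lenR rfl, hk, Expr.eval]

/-- The part of the decision procedure that follows the computation of the size. -/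
def guardedP : Program :=
  .ite (.var nR) (.ite (.var kR)
    (.seq rowsP (.seq connectedP (.ite (.var okR) (.seq paramP allRunsP) .skip))) .skip) .skip

/-- The decision procedure. -/
def decideP : Program :=
  .seq sizeP (.seq guardedP (.set outR (.var resR)))

theorem arr_init_encode (G : SimpleGraph (Fin n)) [DecidableRel G.Adj] (k : ℕ) (i j : Fin n) :
    (RAM.init (FinGraph.encode ⟨n, G⟩) k).arr adjA (i * n + j) = if G.Adj i j then 1 else 0 := by
  classical
  have hlt : i.1 * n + j.1 < n * n := by
    have := Nat.mul_le_mul_right n (Nat.succ_le_of_lt i.2)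
    have := j.2
    rw [Nat.succ_mul] at *
    omega
  have hpos : 0 < n := i.pos
  have h1 : (⟨i.1 * n + j.1, hlt⟩ : Fin (n * n)).divNat = i := by
    ext
    simp [Fin.divNat, Nat.add_div_of_dvd_right (Dvd.intro_left i.1 rfl), hpos]
  have h2 : (⟨i.1 * n + j.1, hlt⟩ : Fin (n * n)).modNat = j := by
    ext
    simp [Fin.modNat, Nat.mod_eq_of_lt j.2]
  simp only [RAM.init, if_true, FinGraph.encode]
  rw [List.getD_eq_getElem _ _ (by simpa using hlt), List.getElem_ofFn]
  simp only [h1, h2]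
  by_cases h : G.Adj i j <;> simp [h]

theorem length_encode (G : FinGraph) : G.encode.length = G.1 * G.1 := by
  simp [FinGraph.encode]

theorem mem_PAVGV_iff {k : ℕ} (hG : G.Connected) (hk : 0 < k) :
    ((⟨n, G⟩, k) : FinGraph × ℕ) ∈ PAVGV ↔ ∃ a, ∃ m < codeBound k, Succeeds G k a m := by
  refine Iff.trans ?_ (exists_search_iff hG k).symm
  simp [PAVGV, hG, hk]

open Classical in
theorem exec_guardedP {k : ℕ} {s : State} (hn : s.reg nR = n) (hk : s.reg kR = k)
    (hadj : ∀ i j : Fin n, s.arr adjA (i * n + j) = if G.Adj i j then 1 else 0)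
    (hstart : s.reg startR = 0) (hres : s.reg resR = 0) :
    Exec guardedP s (9000 * ((k + 3) * (codeBound k + 1) ^ 2 * (n + 1) ^ 5)) fun s' =>
      s'.reg resR = if ((⟨n, G⟩, k) : FinGraph × ℕ) ∈ PAVGV then 1 else 0 := by
  refine (Exec.ite (fun h1 => Exec.ite (fun h2 => Exec.seq ((exec_rowsP hn).imp fun s₁ hf₁ h3 =>
    Exec.seq ((exec_connectedP (G := G) (a := ⟨0, by simp only [Expr.eval] at h1; omega⟩)
      ?_ ?_).imp fun s₂ hf₂ h4 => Exec.ite (fun h5 => Exec.seq ((exec_paramP (k := k) ?_).imp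
        fun s₃ hf₃ h6 => (exec_allRunsP (G := G) ?_ h6.1 h6.2 ?_).imp fun s₄ hf₄ h7 => ?_))
      (fun h5 => Exec.skip ?_)))) (fun h2 => Exec.skip ?_)) (fun h1 => Exec.skip ?_)).mono ?_
  · refine ⟨(hf₁.reg nR rfl).trans hn, fun i j => ?_⟩
    rw [hf₁.arr adjA rfl, h3 i i.2, hadj]
  · rw [hf₁.reg startR rfl, hstart]
  · rw [hf₂.reg kR rfl, hf₁.reg kR rfl, hk]
  · refine ⟨?_, fun i j => ?_⟩
    · rw [hf₃.reg nR rfl, hf₂.reg nR rfl, hf₁.reg nR rfl, hn]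
    · rw [hf₃.arr adjA rfl, hf₂.arr adjA rfl, hf₁.arr adjA rfl, hf₃.arr rowA rfl,
        hf₂.arr rowA rfl, h3 i i.2, hadj]
  · rw [hf₃.reg resR rfl, hf₂.reg resR rfl, hf₁.reg resR rfl, hres]
  · simp only [Expr.eval, h4, ne_eq, ite_eq_right_iff, one_ne_zero, imp_false, not_not] at h5
    simp only [Expr.eval, hk] at h2
    simp only [h7, mem_PAVGV_iff h5 (Nat.pos_of_ne_zero h2)]
  · simp only [Expr.eval, h4, ite_eq_right_iff, one_ne_zero, imp_false] at h5
    rw [if_neg fun h => h5 h.1, hf₂.reg resR rfl, hf₁.reg resR rfl, hres]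
  · simp only [Expr.eval, hk] at h2
    rw [if_neg fun h => h.2.1.ne' h2, hres]
  · simp only [Expr.eval, hn] at h1
    rw [if_neg fun h => ?_, hres]
    obtain ⟨x⟩ := h.1.nonempty
    have hx : 0 < n := x.pos
    omega
  · have h1 : 1 ≤ (k + 3) * (codeBound k + 1) ^ 2 := Nat.one_le_iff_ne_zero.2 (by positivity)
    have h2 : codeBound k ≤ (k + 3) * (codeBound k + 1) ^ 2 := by nlinarith
    have h3 : n + 1 ≤ (n + 1) ^ 5 := Nat.le_self_pow (by omega) _
    have h4 : (n + 1) ^ 3 ≤ (n + 1) ^ 5 := Nat.pow_le_pow_right (by omega) (by omega)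
    have h5 : (n + 1) ^ 5 ≤ (k + 3) * (codeBound k + 1) ^ 2 * (n + 1) ^ 5 :=
      Nat.le_mul_of_pos_left _ h1
    have h6 : codeBound k ≤ (k + 3) * (codeBound k + 1) ^ 2 * (n + 1) ^ 5 :=
      h2.trans (Nat.le_mul_of_pos_right _ (by positivity))
    simp only [Expr.cost]
    rw [mul_assoc 4000, mul_assoc 4000]
    omega

open Classical in
theorem exec_decideP (G : SimpleGraph (Fin n)) (k : ℕ) :
    Exec decideP (RAM.init (FinGraph.encode ⟨n, G⟩) k)
      (10000 * ((k + 3) * (codeBound k + 1) ^ 2 * (n + 1) ^ 5)) fun s' =>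
        s'.reg outR = if ((⟨n, G⟩, k) : FinGraph × ℕ) ∈ PAVGV then 1 else 0 := by
  have hlen : (RAM.init (FinGraph.encode ⟨n, G⟩) k).reg outR = n * n := by
    simp [RAM.init, length_encode]
  refine (Exec.seq ((exec_sizeP hlen rfl rfl).imp fun s₁ hf₁ h1 => Exec.seq ((exec_guardedP
    (G := G) (k := k) h1 ?_ (fun i j => ?_) ?_ ?_).imp fun s₂ _ h2 => Exec.set ?_))).mono ?_
  · rw [hf₁.reg kR rfl]; rfl
  · rw [hf₁.arr adjA rfl, arr_init_encode]
  · rw [hf₁.reg startR rfl]; rfl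
  · rw [hf₁.reg resR rfl]; rfl
  · simpa [Expr.eval] using h2
  · have h1 : 1 ≤ (k + 3) * (codeBound k + 1) ^ 2 := Nat.one_le_iff_ne_zero.2 (by positivity)
    have h2 : n + 1 ≤ (k + 3) * (codeBound k + 1) ^ 2 * (n + 1) ^ 5 :=
      (Nat.le_self_pow (by omega) _).trans (Nat.le_mul_of_pos_left _ h1)
    simp only [Expr.cost]
    omega

/-- The factor of the running time that depends on the parameter is computable. -/
theorem computable_timeBound :
    Computable fun k : ℕ => 320000 * ((k + 3) * (codeBound k + 1) ^ 2) := by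
  have hpow : Primrec₂ fun a b : ℕ => a ^ b := Primrec₂.unpaired'.1 Nat.Primrec.pow
  have hbound : Primrec codeBound :=
    hpow.comp (.const 2) (hpow.comp (.const 2)
      (Primrec.nat_add.comp (Primrec.nat_mul.comp (.const 4) .id) (.const 8)))
  exact (Primrec.nat_mul.comp (.const 320000) (Primrec.nat_mul.comp
    (Primrec.nat_add.comp .id (.const 3))
    (hpow.comp (Primrec.nat_add.comp hbound (.const 1)) (.const 2)))).to_comp

end Decision

end ProfileFPT

open ProfileFPT in
theorem corollary4p5 : FixedParameterTractable FinGraph.encode PAVGV := by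
  refine ⟨decideP, fun k => 320000 * ((k + 3) * (codeBound k + 1) ^ 2), 5, computable_timeBound, ?_⟩
  rintro ⟨n, G⟩ k
  obtain ⟨t, s, hrun, ht, hs⟩ := exec_decideP G k
  refine ⟨t, s, hrun, ht.trans ?_, fun h => ?_, fun h => ?_⟩
  -- The length of the input is `n * n`.
  · have h1 : n + 1 ≤ 2 * (n * n + 1) := by nlinarith
    have h2 := Nat.pow_le_pow_left h1 5
    rw [mul_pow] at h2
    rw [length_encode]
    calc 10000 * ((k + 3) * (codeBound k + 1) ^ 2 * (n + 1) ^ 5)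
        ≤ 10000 * ((k + 3) * (codeBound k + 1) ^ 2 * (2 ^ 5 * (n * n + 1) ^ 5)) := by gcongr
      _ = 320000 * ((k + 3) * (codeBound k + 1) ^ 2) * (n * n + 1) ^ 5 := by ring
  · rw [hs, if_pos h]
  · rw [hs, if_neg h]
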